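/- Let $\Gamma$ and $\Lambda$ be (associative, unital) rings, with $\Gamma$ left coherent and $\Lambda$ right coherent, and write $\Lambda^{\mathrm o}$ for the opposite ring of $\Lambda$. Let $T={}_\Gamma T_\Lambda$ be a Wakamatsu tilting module for the pair $(\Gamma,\Lambda)$, that is, a $(\Gamma,\Lambda)$-bimodule such that 1. the modules ${}_\Gamma T$ and $T_\Lambda$ admit resolutions by finitely generated projective modules; 2. $\operatorname{Ext}^i_\Gamma(T,T)=0$ and $\operatorname{Ext}^i_{\Lambda^{\mathrm o}}(T,T)=0$ for all $i>0$; 3. the canonical maps $\Lambda\to\operatorname{Hom}_\Gamma(T,T)$ and $\Gamma\to\operatorname{Hom}_{\Lambda^{\mathrm o}}(T,T)$ are isomorphisms. Assume that the injective dimensions $\operatorname{id}_\Gamma T$ and $\operatorname{id}_{\Lambda^{\mathrm o}}T$ are finite. Then for every $\ell\in\mathbb Z$ the functors $\operatorname{Ext}^\ell_\Gamma(-,T)$ and $\operatorname{Ext}^\ell_{\Lambda^{\mathrm o}}(-,T)$ (with module structures over $\Lambda^{\mathrm o}$ and $\Gamma$ induced by functoriality in $T$) restrict to an adjoint equivalence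 of categories $$ \left\{ M\in\operatorname{mod}(\Gamma) \;\middle|\; \operatorname{Ext}^i_\Gamma(M,T)=0 \text{ for all } i\neq\ell \right\} \;\rightleftarrows\; \left\{ N\in\operatorname{mod}(\Lambda^{\mathrm o}) \;\middle|\; \operatorname{Ext}^i_{\Lambda^{\mathrm o}}(N,T)=0 \text{ for all } i\neq\ell \right\}^{\mathrm{op}}, $$ where the left adjoint is $\operatorname{Ext}^\ell_\Gamma(-,T)^{\mathrm{op}}$ and the right adjoint is $\operatorname{Ext}^\ell_{\Lambda^{\mathrm o}}(-,T)$. Here $\operatorname{mod}$ denotes the category of finitely presented modules, the index $i$ runs through $\mathbb Z$, $\operatorname{Ext}^i=0$ for $i<0$, and both sides are full subcategories. -/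

import Mathlib

open CategoryTheory

universe u

namespace WakamatsuDuality

/-- A ring is left coherent if each of its finitely generated left ideals is finitely presented. -/
def IsLeftCoherent (R : Type u) [Ring R] : Prop :=
  ∀ I : Ideal R, I.FG → Module.FinitePresentation R I

/-- A ring is right coherent if its opposite ring is left coherent. -/
def IsRightCoherent (R : Type u) [Ring R] : Prop :=
  IsLeftCoherent Rᵐᵒᵖ

/-- The module `T` admits a resolution by finitely generated projective modules. -/
def HasFinGenProjectiveResolution (R : Type u) [Ring R]
    (T : Type u) [AddCommGroup T] [Module R T] : Prop :=
  ∃ P : ProjectiveResolution (ModuleCat.of R T), ∀ n : ℕ, Module.Finite R (P.complex.X n)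

/-- Wakamatsu tilting modules for the pair `(Γ, Λ)`. A `(Γ, Λ)`-bimodule is a left `Γ`-module
which is also a left `Λᵐᵒᵖ`-module (that is, a right `Λ`-module) such that the two actions commute.
The canonical maps in the last two fields are `l ↦ (t ↦ t l)` and `g ↦ (t ↦ g t)`; they are always
homomorphisms of bimodules, so being an isomorphism means being bijective. -/
structure IsWakamatsuTilting (Γ Λ : Type u) [Ring Γ] [Ring Λ]
    (T : Type u) [AddCommGroup T] [Module Γ T] [Module Λᵐᵒᵖ T]
    [SMulCommClass Γ Λᵐᵒᵖ T] [SMulCommClass Λᵐᵒᵖ Γ T] : Prop where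
  resolution_left : HasFinGenProjectiveResolution Γ T
  resolution_right : HasFinGenProjectiveResolution Λᵐᵒᵖ T
  ext_left : ∀ i : ℕ, 0 < i →
    Subsingleton (Abelian.Ext (ModuleCat.of Γ T) (ModuleCat.of Γ T) i)
  ext_right : ∀ i : ℕ, 0 < i →
    Subsingleton (Abelian.Ext (ModuleCat.of Λᵐᵒᵖ T) (ModuleCat.of Λᵐᵒᵖ T) i)
  end_left : Function.Bijective
    (fun l : Λ => (Module.toModuleEnd Γ (S := Λᵐᵒᵖ) T (MulOpposite.op l) : T →ₗ[Γ] T))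
  end_right : Function.Bijective
    (fun g : Γ => (Module.toModuleEnd Λᵐᵒᵖ (S := Γ) T g : T →ₗ[Λᵐᵒᵖ] T))

section Ext

/-! `R` and `S` are rings acting on the left on `T`, and the two actions commute. -/

variable (R S : Type u) [Ring R] [Ring S] (T : Type u) [AddCommGroup T] [Module R T] [Module S T]
  [SMulCommClass S R T]

/-- The action of `s : S` on `T`, as an endomorphism in the category of `R`-modules. -/
def actionHom (s : S) : ModuleCat.of R T ⟶ ModuleCat.of R T :=
  ModuleCat.ofHom (Module.toModuleEnd R (S := S) T s)

/-- The `S`-module structure on `Ext^n_R(M, T)` that comes from functoriality in `T`. -/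
@[reducible]
noncomputable def extModule (M : ModuleCat.{u} R) (n : ℕ) :
    Module S (Abelian.Ext M (ModuleCat.of R T) n) where
  smul s x := x.comp (Abelian.Ext.mk₀ (actionHom R S T s)) (add_zero n)
  one_smul x := by
    change x.comp (Abelian.Ext.mk₀ (actionHom R S T 1)) (add_zero n) = x
    have h : actionHom R S T 1 = 𝟙 _ := by
      ext t; simp [actionHom]
    rw [h, Abelian.Ext.comp_mk₀_id]
  mul_smul a b x := by
    change x.comp (Abelian.Ext.mk₀ (actionHom R S T (a * b))) (add_zero n) =
      (x.comp (Abelian.Ext.mk₀ (actionHom R S T b)) (add_zero n)).comp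
        (Abelian.Ext.mk₀ (actionHom R S T a)) (add_zero n)
    have h : actionHom R S T (a * b) = actionHom R S T b ≫ actionHom R S T a := by
      ext t; simp [actionHom, mul_smul]
    rw [h, Abelian.Ext.comp_assoc_of_third_deg_zero, Abelian.Ext.mk₀_comp_mk₀]
  smul_zero a :=
    Abelian.Ext.zero_comp _ _ (Abelian.Ext.mk₀ (actionHom R S T a)) _ (add_zero n)
  smul_add a x y := Abelian.Ext.add_comp _ _ _ _
  add_smul a b x := by
    change x.comp (Abelian.Ext.mk₀ (actionHom R S T (a + b))) (add_zero n) =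
      x.comp (Abelian.Ext.mk₀ (actionHom R S T a)) (add_zero n) +
        x.comp (Abelian.Ext.mk₀ (actionHom R S T b)) (add_zero n)
    have h : actionHom R S T (a + b) = actionHom R S T a + actionHom R S T b := by
      ext t; simp [actionHom, add_smul]
    rw [h, Abelian.Ext.mk₀_add, Abelian.Ext.comp_add]
  zero_smul x := by
    change x.comp (Abelian.Ext.mk₀ (actionHom R S T 0)) (add_zero n) = 0
    have h : actionHom R S T 0 = 0 := by
      ext t; simp [actionHom]
    rw [h, Abelian.Ext.mk₀_zero, Abelian.Ext.comp_zero]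

/-- The contravariant functor `Ext^n_R(-, T)` from `R`-modules to `S`-modules, for `n : ℕ`. -/
noncomputable def extNat (n : ℕ) : (ModuleCat.{u} R)ᵒᵖ ⥤ ModuleCat.{u} S where
  obj M := @ModuleCat.of S _ (Abelian.Ext M.unop (ModuleCat.of R T) n) _
    (extModule R S T M.unop n)
  map {M N} f :=
    letI := extModule R S T M.unop n
    letI := extModule R S T N.unop n
    ModuleCat.ofHom
      { toFun := fun x => (Abelian.Ext.mk₀ f.unop).comp x (zero_add n)
        map_add' := fun x y => Abelian.Ext.comp_add _ _ _ _
        map_smul' := fun s x =>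
          (Abelian.Ext.comp_assoc_of_third_deg_zero (Abelian.Ext.mk₀ f.unop) x
            (Abelian.Ext.mk₀ (actionHom R S T s)) (zero_add n)).symm }
  map_id M := by
    let _ := extModule R S T M.unop n
    refine ModuleCat.hom_ext (LinearMap.ext fun x => ?_)
    exact Abelian.Ext.mk₀_id_comp x
  map_comp {M N K} f g := by
    let _ := extModule R S T M.unop n
    let _ := extModule R S T K.unop n
    refine ModuleCat.hom_ext (LinearMap.ext fun x => ?_)
    exact (Abelian.Ext.mk₀_comp_mk₀_assoc g.unop f.unop x).symm

/-- The contravariant functor `Ext^ℓ_R(-, T)` from `R`-modules to `S`-modules, for `ℓ : ℤ`;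
it is zero for negative `ℓ`. -/
noncomputable def extInt : ℤ → (ModuleCat.{u} R)ᵒᵖ ⥤ ModuleCat.{u} S
  | Int.ofNat n => extNat R S T n
  | Int.negSucc _ => (Functor.const _).obj (ModuleCat.of S PUnit.{u + 1})

/-- The finitely presented `R`-modules `M` with `Ext^i_R(M, T) = 0` for all integers `i ≠ ℓ`. -/
def extConcentrated (ℓ : ℤ) : ObjectProperty (ModuleCat.{u} R) := fun M =>
  Module.FinitePresentation R M ∧
    ∀ i : ℤ, i ≠ ℓ → Limits.IsZero ((extInt R S T i).obj (Opposite.op M))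

/-- The restriction of `Ext^ℓ_R(-, T)` to a contravariant functor from the finitely presented
`R`-modules with `Ext_R(-, T)` concentrated in degree `ℓ` to the finitely presented `S`-modules
with `Ext_S(-, T)` concentrated in degree `ℓ`, provided that it maps the former to the latter. -/
noncomputable def extRestrict [SMulCommClass R S T] (ℓ : ℤ)
    (h : ∀ M : ModuleCat.{u} R, extConcentrated R S T ℓ M →
      extConcentrated S R T ℓ ((extInt R S T ℓ).obj (Opposite.op M))) :
    (extConcentrated R S T ℓ).FullSubcategoryᵒᵖ ⥤ (extConcentrated S R T ℓ).FullSubcategory :=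
  (extConcentrated S R T ℓ).lift ((extConcentrated R S T ℓ).ι.op ⋙ extInt R S T ℓ)
    (fun M => h M.unop.obj M.unop.property)

end Ext

end WakamatsuDuality

open WakamatsuDuality

/-! Work one-sidedly with commuting rings `R`, `S` acting on `T`, and write M* = Hom_R(M, T). Since
R* ≅ T, the vanishing of Ext_S^i(T, T) for i > 0 and R ≅ End_S(T) say that R is reflexive with
T-acyclic dual (`isReflexiveAcyclic_self`), and so is every finite free module.

Degree 0: let M be finitely presented with Ext_R^i(M, T) = 0 for i > 0, and take 0 → K → P → M → 0
with P finite free. Coherence keeps K finitely presented, K is again acyclic, and 0 → M* → P* → K* →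
0 is exact. Hence Ext_S^i(M*, T) embeds in Ext_S^(i+1)(K*, T) for i > 0. Iterating over syzygies
reaches degrees beyond the injective dimension of T over S, so these groups vanish, and reflexivity
of M follows from that of P (`DualityContext.isReflexiveAcyclic_of_acyclic`).

Degree n + 1: let Q be the image of P* → K*. If n + 1 is the only positive degree where Ext_R(M, T)
may survive, splicing short exact sequences of duals of syzygies gives a natural class η in
Ext_S^(n+1)(Ext_R^(n+1)(M, T), Q). Composition with η computes Ext_S(Ext_R^(n+1)(M, T), T): zero in
degrees at most n, Hom(Q, T) modulo evaluations at elements of K in degree n + 1, and Ext_S^i(Q, T)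
in degree n + 1 + i for i > 0 (`DualityContext.exists_linking`). If moreover M* = 0, then Q ≅ P*;
hence the higher groups vanish and degree n + 1 is P/K ≅ M (`DualityContext.hasNatDuality_succ`).

Applying this to (Γ, Λᵐᵒᵖ) and to (Λᵐᵒᵖ, Γ) gives natural isomorphisms for both composites. The
triangle identities need not be checked for them: any such pair can be corrected to an adjoint
equivalence. -/

namespace WakamatsuDuality

open Abelian Opposite

/-! ### Finitely presented modules over coherent rings -/

section Coherent

variable {R : Type u} [Ring R]

lemma finitePresentation_of_range {M N : Type*} [AddCommGroup M] [Module R M] [AddCommGroup N]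
    [Module R N] (f : M →ₗ[R] N) (hf : Function.Injective f)
    (h : Module.FinitePresentation R (LinearMap.range f)) : Module.FinitePresentation R M :=
  .of_equiv (LinearEquiv.ofInjective f hf).symm

lemma fg_ker_of_finitePresentation_range {M N : Type*} [AddCommGroup M] [Module R M]
    [AddCommGroup N] [Module R N] [Module.Finite R M] (f : M →ₗ[R] N)
    [Module.FinitePresentation R (LinearMap.range f)] : (LinearMap.ker f).FG := by
  rw [← LinearMap.ker_rangeRestrict]
  exact Module.FinitePresentation.fg_ker f.rangeRestrict f.surjective_rangeRestrict

lemma finitePresentation_of_ker_range {M N : Type*} [AddCommGroup M] [Module R M]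
    [AddCommGroup N] [Module R N] (f : M →ₗ[R] N)
    [Module.FinitePresentation R (LinearMap.range f)]
    [h : Module.FinitePresentation R (LinearMap.ker f)] : Module.FinitePresentation R M := by
  rw [← LinearMap.ker_rangeRestrict] at h
  exact Module.finitePresentation_of_ker f.rangeRestrict f.surjective_rangeRestrict

/-- The first coordinate maps M onto a finitely generated left ideal, which is finitely presented by
coherence; so its kernel is finitely generated, and it embeds in one coordinate fewer. -/
lemma IsLeftCoherent.finitePresentation_of_injective_pi (hR : IsLeftCoherent R) (n : ℕ)
    {M : Type*} [AddCommGroup M] [Module R M] [Module.Finite R M] (j : M →ₗ[R] (Fin n → R))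
    (hj : Function.Injective j) : Module.FinitePresentation R M := by
  induction n generalizing M with
  | zero =>
    have := hj.subsingleton
    infer_instance
  | succ n ih =>
    let f : M →ₗ[R] R := LinearMap.proj 0 ∘ₗ j
    have : Module.FinitePresentation R (LinearMap.range f) := hR _ (Submodule.fg_range f)
    have : Module.Finite R (LinearMap.ker f) :=
      Module.Finite.of_fg (fg_ker_of_finitePresentation_range f)
    have : Module.FinitePresentation R (LinearMap.ker f) := by
      -- On the kernel the zeroth coordinate vanishes, so forgetting it remains injective.
      refine ih (LinearMap.funLeft R R Fin.succ ∘ₗ j ∘ₗ (LinearMap.ker f).subtype) ?_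
      refine (injective_iff_map_eq_zero _).mpr fun x hx => Subtype.ext (hj ?_)
      rw [ZeroMemClass.coe_zero, map_zero]
      funext i
      exact Fin.cases x.2 (fun k => congrFun hx k) i
    exact finitePresentation_of_ker_range f

/-- The preimage of U in a finite free cover of M is an extension of U by a finitely generated
kernel. It is finitely presented by the free case, and U is its quotient by that kernel. -/
lemma IsLeftCoherent.finitePresentation_submodule (hR : IsLeftCoherent R)
    {M : Type*} [AddCommGroup M] [Module R M] [Module.FinitePresentation R M]
    (U : Submodule R M) (hU : U.FG) : Module.FinitePresentation R U := by
  obtain ⟨n, f, hf⟩ := Module.Finite.exists_fin' R M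
  have hker := Module.FinitePresentation.fg_ker f hf
  have hcomap : (U.comap f).FG := by
    apply Submodule.fg_of_fg_map_of_fg_inf_ker f
    · rwa [Submodule.map_comap_eq_of_surjective hf]
    · rwa [inf_eq_right.mpr (LinearMap.ker_le_comap (f := f))]
  have := Module.Finite.of_fg hcomap
  have := hR.finitePresentation_of_injective_pi n (U.comap f).subtype Subtype.val_injective
  let g : U.comap f →ₗ[R] U := f.restrict (fun _ hx => hx)
  have hg : Function.Surjective g := by
    rintro ⟨y, hy⟩
    obtain ⟨x, rfl⟩ := hf y
    exact ⟨⟨x, hy⟩, rfl⟩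
  refine Module.finitePresentation_of_surjective g hg ?_
  have : LinearMap.ker g = (LinearMap.ker f).comap (U.comap f).subtype := by
    ext x
    simp [g, Subtype.ext_iff]
  rw [this]
  refine Submodule.fg_of_fg_map_injective (U.comap f).subtype Subtype.val_injective ?_
  rwa [Submodule.map_comap_subtype, inf_eq_right.mpr (LinearMap.ker_le_comap (f := f))]

lemma IsLeftCoherent.finitePresentation_ker (hR : IsLeftCoherent R)
    {M N : Type*} [AddCommGroup M] [Module R M] [AddCommGroup N] [Module R N]
    [Module.FinitePresentation R M] [Module.FinitePresentation R N] (f : M →ₗ[R] N) :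
    Module.FinitePresentation R (LinearMap.ker f) := by
  have := hR.finitePresentation_submodule (LinearMap.range f) (Submodule.fg_range f)
  exact hR.finitePresentation_submodule _ (fg_ker_of_finitePresentation_range f)

lemma finitePresentation_of_exact
    {L M N : Type*} [AddCommGroup L] [Module R L] [AddCommGroup M] [Module R M]
    [AddCommGroup N] [Module R N] [Module.Finite R L] [Module.FinitePresentation R M]
    (f : L →ₗ[R] M) (g : M →ₗ[R] N) (hfg : Function.Exact f g) (hg : Function.Surjective g) :
    Module.FinitePresentation R N := by
  refine Module.finitePresentation_of_surjective g hg ?_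
  rw [LinearMap.exact_iff.mp hfg]
  exact Submodule.fg_range f

lemma finitePresentation_of_extension
    {L M N : Type*} [AddCommGroup L] [Module R L] [AddCommGroup M] [Module R M]
    [AddCommGroup N] [Module R N] [Module.FinitePresentation R L] [Module.FinitePresentation R N]
    (f : L →ₗ[R] M) (g : M →ₗ[R] N) (hf : Function.Injective f) (hfg : Function.Exact f g)
    (hg : Function.Surjective g) : Module.FinitePresentation R M := by
  have : Module.FinitePresentation R (LinearMap.ker g) := by
    rw [LinearMap.exact_iff.mp hfg]
    exact .of_equiv (LinearEquiv.ofInjective f hf)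
  exact Module.finitePresentation_of_ker g hg

lemma IsLeftCoherent.finitePresentation_of_injective_of_exact (hR : IsLeftCoherent R)
    {L M N : Type*} [AddCommGroup L] [Module R L] [AddCommGroup M] [Module R M]
    [AddCommGroup N] [Module R N] [Module.FinitePresentation R M] [Module.FinitePresentation R N]
    (f : L →ₗ[R] M) (g : M →ₗ[R] N) (hf : Function.Injective f) (hfg : Function.Exact f g) :
    Module.FinitePresentation R L := by
  have := hR.finitePresentation_ker g
  rw [LinearMap.exact_iff.mp hfg] at this
  exact finitePresentation_of_range f hf this

end Coherent

lemma extClass_comp_comp_naturality {C : Type*} [Category* C] [Abelian C] [HasExt C]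
    {X Y : ShortComplex C} (hX : X.ShortExact) (hY : Y.ShortExact) (f : X ⟶ Y) {Z : C} {n n' : ℕ}
    (x : Ext Y.X₁ Z n) (h : 1 + n = n') :
    hX.extClass.comp ((Ext.mk₀ f.τ₁).comp x (zero_add n)) h =
      (Ext.mk₀ f.τ₃).comp (hY.extClass.comp x h) (zero_add n') := by
  rw [← Ext.comp_assoc (a₁₂ := 1) _ _ _ (by lia) (by lia) (by lia),
    ← Ext.comp_assoc (a₁₂ := 1) _ _ _ (by lia) (by lia) (by lia),
    ShortComplex.ShortExact.extClass_naturality]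

lemma mk₀_f_comp_mk₀_g_comp {C : Type*} [Category* C] [Abelian C] [HasExt C]
    (X : ShortComplex C) {Z : C} {n : ℕ} (x : Ext X.X₃ Z n) :
    (Ext.mk₀ X.f).comp ((Ext.mk₀ X.g).comp x (zero_add n)) (zero_add n) = 0 := by
  rw [Ext.mk₀_comp_mk₀_assoc, X.zero, Ext.mk₀_zero, Ext.zero_comp]

/-! ### Ext into T as S-modules, long exact sequences, and evaluation maps -/

section Functors

variable (R S : Type u) [Ring R] [Ring S] (T : Type u) [AddCommGroup T] [Module R T] [Module S T]
  [SMulCommClass S R T]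

/-- The `S`-module `Ext^n_R(M, T)`. -/
noncomputable abbrev extObj (n : ℕ) (M : ModuleCat.{u} R) : ModuleCat.{u} S :=
  (extNat R S T n).obj (op M)

variable {R}

/-- The map from Ext of the target to Ext of the source, induced by a morphism of modules. -/
noncomputable abbrev extMap (n : ℕ) {M M' : ModuleCat.{u} R} (f : M ⟶ M') :
    extObj R S T n M' ⟶ extObj R S T n M :=
  (extNat R S T n).map f.op

lemma extMap_comp (n : ℕ) {M M' M'' : ModuleCat.{u} R} (f : M ⟶ M') (g : M' ⟶ M'') :
    extMap S T n (f ≫ g) = extMap S T n g ≫ extMap S T n f := by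
  simp [extMap]

/-- The connecting homomorphism of `S`-modules attached to a short exact sequence
of `R`-modules. -/
noncomputable def extConnecting {X : ShortComplex (ModuleCat.{u} R)} (hX : X.ShortExact) (n : ℕ) :
    extObj R S T n X.X₁ ⟶ extObj R S T (n + 1) X.X₃ :=
  letI := extModule R S T X.X₁ n
  letI := extModule R S T X.X₃ (n + 1)
  ModuleCat.ofHom
    { toFun := fun x : Ext X.X₁ (ModuleCat.of R T) n => hX.extClass.comp x (add_comm 1 n)
      map_add' := fun _ _ => Ext.comp_add _ _ _ _
      map_smul' := fun s x =>
        (Ext.comp_assoc_of_third_deg_zero hX.extClass x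
          (Ext.mk₀ (actionHom R S T s)) (add_comm 1 n)).symm }

lemma extConnecting_naturality {X Y : ShortComplex (ModuleCat.{u} R)} (hX : X.ShortExact)
    (hY : Y.ShortExact) (f : X ⟶ Y) (n : ℕ) :
    extMap S T n f.τ₁ ≫ extConnecting S T hX n =
      extConnecting S T hY n ≫ extMap S T (n + 1) f.τ₃ := by
  ext x
  exact extClass_comp_comp_naturality hX hY f (n := n) x (add_comm 1 n)

lemma extMap_extConnecting {X : ShortComplex (ModuleCat.{u} R)} (hX : X.ShortExact) (n : ℕ) :
    extMap S T n X.f ≫ extConnecting S T hX n = 0 := by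
  ext x
  exact hX.extClass_comp_assoc _ (h := add_comm 1 n)

lemma exact_extMap_extConnecting {X : ShortComplex (ModuleCat.{u} R)} (hX : X.ShortExact) (n : ℕ) :
    Function.Exact (extMap S T n X.f).hom (extConnecting S T hX n).hom := by
  intro y
  constructor
  · exact Ext.contravariant_sequence_exact₁ hX _ y (add_comm 1 n)
  · rintro ⟨x, rfl⟩
    exact hX.extClass_comp_assoc _ (h := add_comm 1 n)

lemma exact_extMap_extMap {X : ShortComplex (ModuleCat.{u} R)} (hX : X.ShortExact) (n : ℕ) :
    Function.Exact (extMap S T n X.g).hom (extMap S T n X.f).hom := by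
  intro y
  constructor
  · exact Ext.contravariant_sequence_exact₂ hX _ y
  · rintro ⟨x, rfl⟩
    exact mk₀_f_comp_mk₀_g_comp X (n := n) x

lemma surjective_extConnecting {X : ShortComplex (ModuleCat.{u} R)} (hX : X.ShortExact) (n : ℕ)
    (h : Subsingleton (Ext X.X₂ (ModuleCat.of R T) (n + 1))) :
    Function.Surjective (extConnecting S T hX n).hom := fun y =>
  Ext.contravariant_sequence_exact₃ hX _ y (Subsingleton.elim _ _) (add_comm 1 n)

lemma injective_extConnecting {X : ShortComplex (ModuleCat.{u} R)} (hX : X.ShortExact) (n : ℕ)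
    (h : Subsingleton (Ext X.X₂ (ModuleCat.of R T) n)) :
    Function.Injective (extConnecting S T hX n).hom := by
  refine (injective_iff_map_eq_zero _).mpr fun y hy => ?_
  obtain ⟨x, rfl⟩ := Ext.contravariant_sequence_exact₁ hX _ y (add_comm 1 n) hy
  rw [Subsingleton.elim x 0]
  exact Ext.comp_zero _ _ _ _ _

lemma injective_extMap_zero {M M' : ModuleCat.{u} R} (f : M ⟶ M') [Epi f] :
    Function.Injective (extMap S T 0 f).hom :=
  Ext.precomp_mk₀_injective_of_epi (ModuleCat.of R T) f

lemma surjective_extMap {X : ShortComplex (ModuleCat.{u} R)} (hX : X.ShortExact) (n : ℕ)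
    (h : Subsingleton (Ext X.X₃ (ModuleCat.of R T) (n + 1))) :
    Function.Surjective (extMap S T n X.f).hom := fun y =>
  Ext.contravariant_sequence_exact₁ hX _ y (add_comm 1 n) (Subsingleton.elim _ _)

/-- Evaluation at `m`, as a map of `S`-modules `Hom_R(M, T) ⟶ T`. -/
noncomputable def evalHom {M : ModuleCat.{u} R} (m : M) :
    extObj R S T 0 M ⟶ ModuleCat.of S T :=
  letI := extModule R S T M 0
  ModuleCat.ofHom
    { toFun := fun x : Ext M (ModuleCat.of R T) 0 => (Ext.addEquiv₀ x).hom m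
      map_add' := fun x y => by rw [map_add]; rfl
      map_smul' := fun s x => by
        obtain ⟨f, rfl⟩ := Ext.addEquiv₀.symm.surjective x
        have : s • (Ext.addEquiv₀.symm f) = Ext.addEquiv₀.symm (f ≫ actionHom R S T s) :=
          Ext.mk₀_comp_mk₀ _ _
        rw [this, AddEquiv.apply_symm_apply, AddEquiv.apply_symm_apply]
        rfl }

lemma evalHom_mk₀ {M : ModuleCat.{u} R} (m : M) (f : M ⟶ ModuleCat.of R T) :
    (evalHom S T m).hom (Ext.mk₀ f) = f.hom m := by
  change (Ext.addEquiv₀ (Ext.addEquiv₀.symm f)).hom m = _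
  rw [AddEquiv.apply_symm_apply]

variable {S T} in
lemma hom_ext_extObj_zero {M : ModuleCat.{u} R} {N : ModuleCat.{u} S} {f g : extObj R S T 0 M ⟶ N}
    (h : ∀ a : M ⟶ ModuleCat.of R T, f.hom (Ext.mk₀ a) = g.hom (Ext.mk₀ a)) : f = g := by
  ext x
  obtain ⟨a, rfl⟩ := Ext.addEquiv₀.symm.surjective x
  exact h a

lemma extMap_evalHom {M M' : ModuleCat.{u} R} (f : M ⟶ M') (m : M) :
    extMap S T 0 f ≫ evalHom S T m = evalHom S T (f.hom m) := by
  refine hom_ext_extObj_zero fun a => ?_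
  change (evalHom S T m).hom ((Ext.mk₀ f).comp (Ext.mk₀ a) (zero_add 0)) = _
  rw [Ext.mk₀_comp_mk₀, evalHom_mk₀, evalHom_mk₀]
  rfl

lemma evalHom_add {M : ModuleCat.{u} R} (m m' : M) :
    evalHom S T (m + m') = evalHom S T m + evalHom S T m' := by
  refine hom_ext_extObj_zero fun a => ?_
  change _ = (evalHom S T m).hom (Ext.mk₀ a) + (evalHom S T m').hom (Ext.mk₀ a)
  rw [evalHom_mk₀, evalHom_mk₀, evalHom_mk₀, map_add]

lemma evalHom_zero (M : ModuleCat.{u} R) : evalHom S T (0 : M) = 0 := by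
  refine hom_ext_extObj_zero fun a => ?_
  rw [evalHom_mk₀, map_zero]
  rfl

lemma evalHom_sub {M : ModuleCat.{u} R} (m m' : M) :
    evalHom S T (m - m') = evalHom S T m - evalHom S T m' := by
  rw [eq_sub_iff_add_eq, ← evalHom_add, sub_add_cancel]

variable [SMulCommClass R S T]

lemma evalHom_smul {M : ModuleCat.{u} R} (r : R) (m : M) :
    evalHom S T (r • m) = evalHom S T m ≫ actionHom S R T r := by
  refine hom_ext_extObj_zero fun a => ?_
  change _ = r • (evalHom S T m).hom (Ext.mk₀ a)
  rw [evalHom_mk₀, evalHom_mk₀, map_smul]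

end Functors

lemma subsingleton_ext_X₂ {C : Type*} [Category* C] [Abelian C] [HasExt C]
    {X : ShortComplex C} (hX : X.ShortExact) {Z : C} {n : ℕ} (h₁ : Subsingleton (Ext X.X₁ Z n))
    (h₃ : Subsingleton (Ext X.X₃ Z n)) : Subsingleton (Ext X.X₂ Z n) := by
  refine subsingleton_of_forall_eq 0 fun x => ?_
  obtain ⟨y, rfl⟩ := Ext.contravariant_sequence_exact₂ hX Z x (Subsingleton.elim _ _)
  rw [Subsingleton.elim y 0, Ext.comp_zero]

lemma subsingleton_ext_of_iso {C : Type*} [Category* C] [Abelian C] [HasExt C]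
    {X Y : C} (e : X ≅ Y) {Z : C} {n : ℕ} (h : Subsingleton (Ext Y Z n)) :
    Subsingleton (Ext X Z n) := by
  refine subsingleton_of_forall_eq 0 fun x => ?_
  have : x = (Ext.mk₀ e.hom).comp ((Ext.mk₀ e.inv).comp x (zero_add n)) (zero_add n) := by
    rw [Ext.mk₀_comp_mk₀_assoc, e.hom_inv_id, Ext.mk₀_id_comp]
  rw [this, Subsingleton.elim ((Ext.mk₀ e.inv).comp x (zero_add n)) 0, Ext.comp_zero]

lemma subsingleton_ext_of_isZero {C : Type*} [Category* C] [Abelian C] [HasExt C]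
    {X : C} (hX : Limits.IsZero X) (Z : C) (n : ℕ) : Subsingleton (Ext X Z n) := by
  refine subsingleton_of_forall_eq 0 fun x => ?_
  rw [← Ext.mk₀_id_comp x, hX.eq_of_src (𝟙 X) 0, Ext.mk₀_zero, Ext.zero_comp]

/-! ### Modules that are reflexive and acyclic with respect to T -/

section Reflexive

variable (R S : Type u) [Ring R] [Ring S] (T : Type u) [AddCommGroup T] [Module R T] [Module S T]
  [SMulCommClass S R T]

/-- An `R`-module `M` is reflexive and acyclic with respect to `T` if the higher `Ext`-groups from
`M` to `T` and from `Hom_R(M, T)` to `T` vanish, and `M` is isomorphic to its double dual. -/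
structure IsReflexiveAcyclic (M : ModuleCat.{u} R) : Prop where
  subsingleton_ext (n : ℕ) : Subsingleton (Ext M (ModuleCat.of R T) (n + 1))
  subsingleton_ext_dual (n : ℕ) :
    Subsingleton (Ext (extObj R S T 0 M) (ModuleCat.of S T) (n + 1))
  eq_zero_of_evalHom (m : M) : evalHom S T m = 0 → m = 0
  exists_evalHom (φ : extObj R S T 0 M ⟶ ModuleCat.of S T) : ∃ m : M, evalHom S T m = φ

variable {R}

/-- The image of a short complex under `Hom_R(-, T)`. -/
noncomputable abbrev dualComplex (X : ShortComplex (ModuleCat.{u} R)) :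
    ShortComplex (ModuleCat.{u} S) :=
  ShortComplex.mk (extMap S T 0 X.g) (extMap S T 0 X.f) (by
    ext x
    exact mk₀_f_comp_mk₀_g_comp X (n := 0) x)

lemma shortExact_dualComplex {X : ShortComplex (ModuleCat.{u} R)} (hX : X.ShortExact)
    (h : Subsingleton (Ext X.X₃ (ModuleCat.of R T) 1)) : (dualComplex S T X).ShortExact :=
  have := hX.epi_g
  ModuleCat.shortComplex_shortExact _ (exact_extMap_extMap S T hX 0)
    (injective_extMap_zero S T X.g) (surjective_extMap S T hX 0 h)

variable {S T}

lemma IsReflexiveAcyclic.eq_of_evalHom {M : ModuleCat.{u} R} (h : IsReflexiveAcyclic R S T M)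
    {m m' : M} (hm : evalHom S T m = evalHom S T m') : m = m' :=
  sub_eq_zero.mp (h.eq_zero_of_evalHom _ (by rw [evalHom_sub, hm, sub_self]))

/-- Since Ext^1(X₃, T) = 0, the dual sequence is short exact. The vanishing statements then come
from the two long exact sequences, and bijectivity of biduality from a five-lemma chase. -/
lemma IsReflexiveAcyclic.of_shortExact {X : ShortComplex (ModuleCat.{u} R)} (hX : X.ShortExact)
    (h₁ : IsReflexiveAcyclic R S T X.X₁) (h₃ : IsReflexiveAcyclic R S T X.X₃) :
    IsReflexiveAcyclic R S T X.X₂ where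
  subsingleton_ext n := subsingleton_ext_X₂ hX (h₁.subsingleton_ext n) (h₃.subsingleton_ext n)
  subsingleton_ext_dual n :=
    subsingleton_ext_X₂ (shortExact_dualComplex S T hX (h₃.subsingleton_ext 0))
      (h₃.subsingleton_ext_dual n) (h₁.subsingleton_ext_dual n)
  eq_zero_of_evalHom b hb := by
    have := (shortExact_dualComplex S T hX (h₃.subsingleton_ext 0)).epi_g
    have hgb : X.g.hom b = 0 := h₃.eq_zero_of_evalHom _ (by
      rw [← extMap_evalHom, hb, Limits.comp_zero])
    obtain ⟨a, rfl⟩ := (ShortComplex.moduleCat_exact_iff _).mp hX.exact b hgb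
    have ha : a = 0 := h₁.eq_zero_of_evalHom _ (by
      rw [← cancel_epi (dualComplex S T X).g, Limits.comp_zero, ← hb]
      exact extMap_evalHom S T X.f a)
    rw [ha, map_zero]
  exists_evalHom φ := by
    have hD := shortExact_dualComplex S T hX (h₃.subsingleton_ext 0)
    have := hD.epi_g
    obtain ⟨c, hc⟩ := h₃.exists_evalHom (extMap S T 0 X.g ≫ φ)
    obtain ⟨b, rfl⟩ := hX.moduleCat_surjective_g c
    have hker : (dualComplex S T X).f ≫ (φ - evalHom S T b) = 0 := by
      rw [Preadditive.comp_sub]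
      change extMap S T 0 X.g ≫ φ - extMap S T 0 X.g ≫ _ = 0
      rw [← hc, extMap_evalHom, sub_self]
    obtain ⟨a, ha⟩ := h₁.exists_evalHom (hD.exact.desc _ hker)
    refine ⟨X.f.hom a + b, ?_⟩
    rw [evalHom_add, ← extMap_evalHom, ha, ← eq_sub_iff_add_eq]
    exact hD.exact.g_desc _ hker

lemma IsReflexiveAcyclic.of_isZero {M : ModuleCat.{u} R} (hM : Limits.IsZero M) :
    IsReflexiveAcyclic R S T M := by
  have := ModuleCat.subsingleton_of_isZero hM
  have h0 : Limits.IsZero (extObj R S T 0 M) := by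
    have : Subsingleton (extObj R S T 0 M) := subsingleton_ext_of_isZero hM _ 0
    exact ModuleCat.isZero_of_subsingleton _
  exact
  { subsingleton_ext := fun n => subsingleton_ext_of_isZero hM _ _
    subsingleton_ext_dual := fun n => subsingleton_ext_of_isZero h0 _ _
    eq_zero_of_evalHom := fun m _ => Subsingleton.elim _ _
    exists_evalHom := fun φ => ⟨0, h0.eq_of_src _ _⟩ }

lemma bijective_evalHom_one :
    Function.Bijective (evalHom S T (1 : ModuleCat.of R R)).hom := by
  constructor
  · refine (injective_iff_map_eq_zero _).mpr fun x hx => ?_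
    obtain ⟨a, rfl⟩ := Ext.addEquiv₀.symm.surjective x
    have ha : a.hom 1 = 0 := (evalHom_mk₀ S T _ a).symm.trans hx
    have : a = 0 := by
      ext
      exact ha
    rw [this]
    exact Ext.mk₀_zero _ _
  · intro t
    let a : ModuleCat.of R R ⟶ ModuleCat.of R T :=
      ModuleCat.ofHom (LinearMap.toSpanSingleton R T t)
    exact ⟨Ext.mk₀ a, (evalHom_mk₀ S T (1 : ModuleCat.of R R) a).trans (one_smul R t)⟩

/-- The short exact sequence `0 ⟶ R ⟶ R^(n+1) ⟶ R^n ⟶ 0`. -/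
noncomputable abbrev piSuccComplex (R : Type u) [Ring R] (n : ℕ) :
    ShortComplex (ModuleCat.{u} R) :=
  ModuleCat.shortComplexOfCompEqZero
    (LinearMap.single R (fun _ : Fin (n + 1) => R) 0)
    (LinearMap.funLeft R R (Fin.succ : Fin n → Fin (n + 1))) (by
      ext i
      simp [LinearMap.funLeft_apply])

lemma shortExact_piSuccComplex (R : Type u) [Ring R] (n : ℕ) :
    (piSuccComplex R n).ShortExact := by
  refine ModuleCat.shortComplex_shortExact _ ?_ ?_ ?_
  · change Function.Exact (LinearMap.single R (fun _ : Fin (n + 1) => R) 0)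
      (LinearMap.funLeft R R (Fin.succ : Fin n → Fin (n + 1)))
    intro v
    constructor
    · intro hv
      refine ⟨v 0, funext fun i => ?_⟩
      refine Fin.cases (by simp) (fun j => ?_) i
      simpa using (congrFun hv j).symm
    · rintro ⟨x, rfl⟩
      ext i
      simp [LinearMap.funLeft_apply]
  · exact Pi.single_injective (M := fun _ : Fin (n + 1) => R) 0
  · exact LinearMap.funLeft_surjective_of_injective R R Fin.succ (Fin.succ_injective n)

lemma isReflexiveAcyclic_pi (h : IsReflexiveAcyclic R S T (ModuleCat.of R R)) (n : ℕ) :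
    IsReflexiveAcyclic R S T (ModuleCat.of R (Fin n → R)) := by
  induction n with
  | zero => exact .of_isZero (ModuleCat.isZero_of_subsingleton _)
  | succ n ih => exact .of_shortExact (shortExact_piSuccComplex R n) h ih

variable [SMulCommClass R S T]

/-- Evaluation at 1 identifies R* with T and evaluation at r with the action of r, so the claims
become the vanishing of Ext_S^i(T, T) for i > 0 and the bijectivity of R → End_S(T). -/
lemma isReflexiveAcyclic_self
    (hext : ∀ i : ℕ, 0 < i → Subsingleton (Ext (ModuleCat.of S T) (ModuleCat.of S T) i))
    (hend : Function.Bijective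
      (fun r : R => (Module.toModuleEnd S (S := R) T r : T →ₗ[S] T))) :
    IsReflexiveAcyclic R S T (ModuleCat.of R R) := by
  have hiso : IsIso (evalHom S T (1 : ModuleCat.of R R)) :=
    (ConcreteCategory.isIso_iff_bijective _).mpr bijective_evalHom_one
  have hev (r : R) : evalHom S T (r : ModuleCat.of R R) =
      evalHom S T (1 : ModuleCat.of R R) ≫ actionHom S R T r := by
    rw [← evalHom_smul]
    congr 1
    exact (mul_one r).symm
  refine ⟨fun n => Ext.subsingleton_of_projective _ _ _, fun n => ?_, fun r hr => ?_, fun φ => ?_⟩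
  · exact subsingleton_ext_of_iso (asIso (evalHom S T (1 : ModuleCat.of R R))) (hext _ n.succ_pos)
  · have h := hev r
    rw [hr] at h
    have h' : actionHom S R T r = 0 := by
      rw [← cancel_epi (evalHom S T (1 : ModuleCat.of R R)), ← h, Limits.comp_zero]
    apply hend.1
    change Module.toModuleEnd S (S := R) T r = Module.toModuleEnd S (S := R) T 0
    rw [map_zero]
    exact congrArg ModuleCat.Hom.hom h'
  · obtain ⟨r, hr⟩ := hend.2 (inv (evalHom S T (1 : ModuleCat.of R R)) ≫ φ).hom
    refine ⟨r, ?_⟩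
    have : actionHom S R T r = inv (evalHom S T (1 : ModuleCat.of R R)) ≫ φ :=
      ModuleCat.hom_ext hr
    rw [hev, this, IsIso.hom_inv_id_assoc]

end Reflexive

lemma subsingleton_ext_X₁ {C : Type*} [Category* C] [Abelian C] [HasExt C]
    {X : ShortComplex C} (hX : X.ShortExact) {Z : C} {n : ℕ} (h₂ : Subsingleton (Ext X.X₂ Z n))
    (h₃ : Subsingleton (Ext X.X₃ Z (n + 1))) : Subsingleton (Ext X.X₁ Z n) := by
  refine subsingleton_of_forall_eq 0 fun x => ?_
  obtain ⟨y, rfl⟩ := Ext.contravariant_sequence_exact₁ hX Z x (add_comm 1 n)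
    (Subsingleton.elim _ _)
  rw [Subsingleton.elim y 0, Ext.comp_zero]

lemma extClass_comp_mk₀_eq_zero_iff {C : Type*} [Category* C] [Abelian C] [HasExt C]
    {X : ShortComplex C} (hX : X.ShortExact) {Z : C} (φ : X.X₁ ⟶ Z) :
    hX.extClass.comp (Ext.mk₀ φ) (add_zero 1) = 0 ↔ ∃ ψ : X.X₂ ⟶ Z, X.f ≫ ψ = φ := by
  constructor
  · intro h
    obtain ⟨y, hy⟩ := Ext.contravariant_sequence_exact₁ hX Z (Ext.mk₀ φ) (add_zero 1) h
    obtain ⟨ψ, rfl⟩ := Ext.addEquiv₀.symm.surjective y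
    refine ⟨ψ, Ext.addEquiv₀.symm.injective ?_⟩
    rw [Ext.addEquiv₀_symm_apply, Ext.addEquiv₀_symm_apply, ← hy, Ext.addEquiv₀_symm_apply,
      Ext.mk₀_comp_mk₀]
  · rintro ⟨ψ, rfl⟩
    rw [← Ext.mk₀_comp_mk₀]
    exact hX.extClass_comp_assoc _

lemma exists_f_comp_eq {C : Type*} [Category* C] [Abelian C] [HasExt C]
    {X : ShortComplex C} (hX : X.ShortExact) {Z : C} (h : Subsingleton (Ext X.X₃ Z 1))
    (φ : X.X₁ ⟶ Z) : ∃ ψ : X.X₂ ⟶ Z, X.f ≫ ψ = φ :=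
  (extClass_comp_mk₀_eq_zero_iff hX φ).mp (Subsingleton.elim _ _)

/-! ### Finite free covers and syzygies -/

section Syzygy

variable {R : Type u} [Ring R] (M : ModuleCat.{u} R) [Module.Finite R M]

/-- The rank of a chosen finite free module which surjects onto `M`. -/
noncomputable def coverRank : ℕ := (Module.Finite.exists_fin' R M).choose

/-- A chosen surjection from a finite free module onto `M`. -/
noncomputable def coverMap : (Fin (coverRank M) → R) →ₗ[R] M :=
  (Module.Finite.exists_fin' R M).choose_spec.choose

lemma surjective_coverMap : Function.Surjective (coverMap M) :=
  (Module.Finite.exists_fin' R M).choose_spec.choose_spec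

/-- The short exact sequence `0 ⟶ K ⟶ R^n ⟶ M ⟶ 0` given by the chosen finite free cover. -/
noncomputable abbrev syzygyComplex : ShortComplex (ModuleCat.{u} R) where
  X₁ := ModuleCat.of R (LinearMap.ker (coverMap M))
  X₂ := ModuleCat.of R (Fin (coverRank M) → R)
  X₃ := M
  f := ModuleCat.ofHom (LinearMap.ker (coverMap M)).subtype
  g := ModuleCat.ofHom (coverMap M)
  zero := by
    ext x
    exact x.2

lemma shortExact_syzygyComplex : (syzygyComplex M).ShortExact :=
  LinearMap.shortExact_shortComplexKer (surjective_coverMap M)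

/-- The chosen first syzygy of `M`. -/
noncomputable abbrev syzygy : ModuleCat.{u} R := (syzygyComplex M).X₁

lemma IsLeftCoherent.finitePresentation_syzygy (hR : IsLeftCoherent R)
    [Module.FinitePresentation R M] : Module.FinitePresentation R (syzygy M) :=
  hR.finitePresentation_submodule _ (Module.FinitePresentation.fg_ker _ (surjective_coverMap M))

variable {M} in
-- The lift to covers exists by projectivity. It is not unique, so the naturality statements for
-- linking classes are made for an arbitrary lift.
lemma exists_syzygyComplex_map {M' : ModuleCat.{u} R} [Module.Finite R M'] (f : M ⟶ M') :
    ∃ F : syzygyComplex M ⟶ syzygyComplex M', F.τ₃ = f := by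
  have hM' := shortExact_syzygyComplex M'
  have := hM'.epi_g
  have := hM'.mono_f
  let p : (syzygyComplex M).X₂ ⟶ (syzygyComplex M').X₂ :=
    Projective.factorThru ((syzygyComplex M).g ≫ f) (syzygyComplex M').g
  have hp : p ≫ (syzygyComplex M').g = (syzygyComplex M).g ≫ f := Projective.factorThru_comp _ _
  have hk : ((syzygyComplex M).f ≫ p) ≫ (syzygyComplex M').g = 0 := by
    rw [Category.assoc, hp, ShortComplex.zero_assoc, Limits.zero_comp]
  exact ⟨{ τ₁ := hM'.exact.lift _ hk
           τ₂ := p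
           τ₃ := f
           comm₁₂ := hM'.exact.lift_f _ hk
           comm₂₃ := hp }, rfl⟩

end Syzygy

/-! ### One-sided duality for acyclic modules; finite presentation of Ext -/

section Setup

/-- The hypotheses on rings `R` and `S` and a bimodule `T` under which the functors `Ext_R(-, T)`
followed by `Ext_S(-, T)` recover a finitely presented `R`-module. -/
structure DualityContext (R S : Type u) [Ring R] [Ring S] (T : Type u) [AddCommGroup T]
    [Module R T] [Module S T] [SMulCommClass S R T] : Prop where
  coherent : IsLeftCoherent R
  coherent' : IsLeftCoherent S
  finitePresentation : Module.FinitePresentation S T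
  isReflexiveAcyclic : IsReflexiveAcyclic R S T (ModuleCat.of R R)
  exists_bound : ∃ d : ℕ, ∀ i, d ≤ i → ∀ N : ModuleCat.{u} S,
    Subsingleton (Ext N (ModuleCat.of S T) i)

variable {R S : Type u} [Ring R] [Ring S] {T : Type u} [AddCommGroup T] [Module R T] [Module S T]
  [SMulCommClass S R T] (H : DualityContext R S T)

include H

lemma DualityContext.isReflexiveAcyclic_cover (M : ModuleCat.{u} R) [Module.Finite R M] :
    IsReflexiveAcyclic R S T (syzygyComplex M).X₂ :=
  isReflexiveAcyclic_pi H.isReflexiveAcyclic _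

omit H in
lemma subsingleton_ext_syzygy (M : ModuleCat.{u} R) [Module.Finite R M] (n : ℕ)
    (h : Subsingleton (Ext M (ModuleCat.of R T) (n + 2))) :
    Subsingleton (Ext (syzygy M) (ModuleCat.of R T) (n + 1)) :=
  subsingleton_ext_X₁ (shortExact_syzygyComplex M) (Ext.subsingleton_of_projective _ _ _) h

/-- From 0 → M* → P* → K* → 0 with P* acyclic, Ext^(n+1)(M*, T) is controlled by Ext^(n+2)(K*, T),
where K is again acyclic; the degree eventually exceeds the injective dimension of T. -/
lemma DualityContext.subsingleton_ext_dual (M : ModuleCat.{u} R) [Module.FinitePresentation R M]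
    (hM : ∀ n, Subsingleton (Ext M (ModuleCat.of R T) (n + 1))) (n : ℕ) :
    Subsingleton (Ext (extObj R S T 0 M) (ModuleCat.of S T) (n + 1)) := by
  obtain ⟨d, hd⟩ := H.exists_bound
  -- Here k bounds the number of shifts left before the degree reaches d; M and n must vary, since
  -- each shift replaces M by its syzygy and raises n.
  suffices ∀ k (M : ModuleCat.{u} R) [Module.FinitePresentation R M]
      (_ : ∀ n, Subsingleton (Ext M (ModuleCat.of R T) (n + 1))) (n : ℕ) (_ : d ≤ n + 1 + k),
      Subsingleton (Ext (extObj R S T 0 M) (ModuleCat.of S T) (n + 1)) from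
    this d M hM n (by lia)
  intro k
  induction k with
  | zero => exact fun M _ _ n hn => hd _ hn _
  | succ k ih =>
    intro M _ hM n hn
    have := H.coherent.finitePresentation_syzygy M
    exact subsingleton_ext_X₁
      (shortExact_dualComplex S T (shortExact_syzygyComplex M) (hM 0))
      ((H.isReflexiveAcyclic_cover M).subsingleton_ext_dual n)
      (ih (syzygy M) (fun n => subsingleton_ext_syzygy M n (hM (n + 1))) (n + 1) (by lia))

/-- The obstruction to extending φ from M* to P* lies in Ext^1(K*, T) = 0. The extension is
evaluation at some p in P, and φ is evaluation at the image of p. -/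
lemma DualityContext.exists_evalHom (M : ModuleCat.{u} R) [Module.FinitePresentation R M]
    (hM : ∀ n, Subsingleton (Ext M (ModuleCat.of R T) (n + 1)))
    (φ : extObj R S T 0 M ⟶ ModuleCat.of S T) : ∃ m : M, evalHom S T m = φ := by
  have := H.coherent.finitePresentation_syzygy M
  obtain ⟨ψ, hψ⟩ := exists_f_comp_eq
    (shortExact_dualComplex S T (shortExact_syzygyComplex M) (hM 0))
    (H.subsingleton_ext_dual (syzygy M) (fun n => subsingleton_ext_syzygy M n (hM (n + 1))) 0) φ
  obtain ⟨p, rfl⟩ := (H.isReflexiveAcyclic_cover M).exists_evalHom ψ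
  exact ⟨(syzygyComplex M).g.hom p, (extMap_evalHom S T (syzygyComplex M).g p).symm.trans hψ⟩

/-- Finitely presented modules without higher extensions by `T` are reflexive. -/
lemma DualityContext.isReflexiveAcyclic_of_acyclic (M : ModuleCat.{u} R)
    [Module.FinitePresentation R M]
    (hM : ∀ n, Subsingleton (Ext M (ModuleCat.of R T) (n + 1))) :
    IsReflexiveAcyclic R S T M where
  subsingleton_ext := hM
  subsingleton_ext_dual := H.subsingleton_ext_dual M hM
  exists_evalHom := H.exists_evalHom M hM
  eq_zero_of_evalHom m hm := by
    have := H.coherent.finitePresentation_syzygy M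
    have hD := shortExact_dualComplex S T (shortExact_syzygyComplex M) (hM 0)
    have := hD.epi_g
    obtain ⟨p, rfl⟩ := surjective_coverMap M m
    have hp : (dualComplex S T (syzygyComplex M)).f ≫ evalHom S T p = 0 :=
      (extMap_evalHom S T (syzygyComplex M).g p).trans hm
    -- Evaluation at p kills M*, so it factors through K*, where it is evaluation at some k in K;
    -- reflexivity of P then forces p = k.
    obtain ⟨k, hk⟩ := H.exists_evalHom (syzygy M)
      (fun n => subsingleton_ext_syzygy M n (hM (n + 1))) (hD.exact.desc _ hp)
    have hpk : evalHom S T p = evalHom S T ((syzygyComplex M).f.hom k) := by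
      rw [← extMap_evalHom, hk]
      exact (hD.exact.g_desc _ hp).symm
    rw [(H.isReflexiveAcyclic_cover M).eq_of_evalHom hpk]
    exact k.2

lemma DualityContext.finitePresentation_dual_pi (n : ℕ) :
    Module.FinitePresentation S (extObj R S T 0 (ModuleCat.of R (Fin n → R))) := by
  induction n with
  | zero =>
    have : Subsingleton (extObj R S T 0 (ModuleCat.of R (Fin 0 → R))) :=
      subsingleton_ext_of_isZero (ModuleCat.isZero_of_subsingleton _) _ 0
    infer_instance
  | succ n ih =>
    have := H.finitePresentation
    have hD := shortExact_dualComplex S T (shortExact_piSuccComplex R n)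
      (Ext.subsingleton_of_projective _ _ _)
    have h₃ : Module.FinitePresentation S (extObj R S T 0 (ModuleCat.of R R)) :=
      .of_equiv (LinearEquiv.ofBijective (evalHom S T (1 : ModuleCat.of R R)).hom
        bijective_evalHom_one).symm
    exact finitePresentation_of_extension (dualComplex S T (piSuccComplex R n)).f.hom
      (dualComplex S T (piSuccComplex R n)).g.hom hD.moduleCat_injective_f
      ((ShortComplex.ShortExact.moduleCat_exact_iff_function_exact _).mp hD.exact)
      hD.moduleCat_surjective_g

lemma DualityContext.finitePresentation_extObj (n : ℕ) (M : ModuleCat.{u} R)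
    [Module.FinitePresentation R M] : Module.FinitePresentation S (extObj R S T n M) := by
  have hdual (M : ModuleCat.{u} R) [Module.FinitePresentation R M] :
      Module.FinitePresentation S (extObj R S T 0 M) := by
    have := H.coherent.finitePresentation_syzygy M
    have h₂ : Module.FinitePresentation S (extObj R S T 0 (syzygyComplex M).X₂) :=
      H.finitePresentation_dual_pi _
    have h₃ : Module.FinitePresentation S (extObj R S T 0 (syzygyComplex (syzygy M)).X₂) :=
      H.finitePresentation_dual_pi _
    have := (shortExact_syzygyComplex M).epi_g
    have := (shortExact_syzygyComplex (syzygy M)).epi_g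
    -- With a cover P₁ → K, the dual M* is the kernel of P* → P₁*, since K* embeds in P₁*; coherence
    -- of S applies.
    refine H.coherent'.finitePresentation_of_injective_of_exact
      (extMap S T 0 (syzygyComplex M).g).hom
      ((extMap S T 0 (syzygyComplex (syzygy M)).g).hom ∘ₗ (extMap S T 0 (syzygyComplex M).f).hom)
      (injective_extMap_zero S T _) ?_
    exact (exact_extMap_extMap S T (shortExact_syzygyComplex M) 0).comp_injective _
      (injective_extMap_zero S T (syzygyComplex (syzygy M)).g) (map_zero _)
  cases n with
  | zero => exact hdual M
  | succ n =>
    induction n generalizing M with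
    | zero =>
      have := H.coherent.finitePresentation_syzygy M
      have h₁ : Module.FinitePresentation S (extObj R S T 0 (syzygy M)) := hdual _
      have h₂ : Module.FinitePresentation S (extObj R S T 0 (syzygyComplex M).X₂) :=
        H.finitePresentation_dual_pi _
      exact finitePresentation_of_exact _ _
        (exact_extMap_extConnecting S T (shortExact_syzygyComplex M) 0)
        (surjective_extConnecting S T (shortExact_syzygyComplex M) 0
          (Ext.subsingleton_of_projective _ _ _))
    | succ n ih =>
      have := H.coherent.finitePresentation_syzygy M
      have h₁ := ih (syzygy M)
      exact .of_equiv (LinearEquiv.ofBijective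
        (extConnecting S T (shortExact_syzygyComplex M) (n + 1)).hom
        ⟨injective_extConnecting S T _ _ (Ext.subsingleton_of_projective _ _ _),
          surjective_extConnecting S T _ _ (Ext.subsingleton_of_projective _ _ _)⟩)

end Setup

/-! ### Dimension shifting by Yoneda composition with a fixed class -/

section Linking

variable {C : Type*} [Category* C] [Abelian C] [HasExt C]

lemma comp_naturality {A A' B B' D D' : C} {a : A' ⟶ A} {b : B' ⟶ B} {c : D' ⟶ D} {n m k : ℕ}
    {η : Ext A B n} {η' : Ext A' B' n} {θ : Ext B D m} {θ' : Ext B' D' m} (h : n + m = k)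
    (hη : (Ext.mk₀ a).comp η (zero_add n) = η'.comp (Ext.mk₀ b) (add_zero n))
    (hθ : (Ext.mk₀ b).comp θ (zero_add m) = θ'.comp (Ext.mk₀ c) (add_zero m)) :
    (Ext.mk₀ a).comp (η.comp θ h) (zero_add k) =
      (η'.comp θ' h).comp (Ext.mk₀ c) (add_zero k) := by
  rw [← Ext.comp_assoc _ _ _ (zero_add n) h (by lia), hη,
    Ext.comp_assoc_of_second_deg_zero, hθ, Ext.comp_assoc_of_third_deg_zero]

lemma mk₀_naturality {A A' B B' : C} {a : A' ⟶ A} {b : B' ⟶ B} {g : A ⟶ B} {g' : A' ⟶ B'}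
    (h : a ≫ g = g' ≫ b) :
    (Ext.mk₀ a).comp (Ext.mk₀ g) (zero_add 0) = (Ext.mk₀ g').comp (Ext.mk₀ b) (add_zero 0) := by
  rw [Ext.mk₀_comp_mk₀, Ext.mk₀_comp_mk₀, h]

/-- A class `η : Ext^(n+1)(A, B)` is linking with respect to `Z` if composition with `η` identifies
`Ext^i(B, Z)` with `Ext^(n+1+i)(A, Z)` for `i > 0`, identifies the quotient of `B ⟶ Z` by the set
`V` with `Ext^(n+1)(A, Z)`, and the groups `Ext^i(A, Z)` with `i ≤ n` vanish. -/
structure IsLinking {A B Z : C} {n : ℕ} (η : Ext A B (n + 1)) (V : Set (B ⟶ Z)) : Prop where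
  exists_comp {i m : ℕ} (h : n + 1 + i = m) (x : Ext A Z m) : ∃ y : Ext B Z i, η.comp y h = x
  eq_zero {i m : ℕ} (h : n + 1 + (i + 1) = m) (y : Ext B Z (i + 1)) : η.comp y h = 0 → y = 0
  comp_mk₀_eq_zero_iff (φ : B ⟶ Z) : η.comp (Ext.mk₀ φ) (add_zero (n + 1)) = 0 ↔ φ ∈ V
  subsingleton (i : ℕ) (hi : i ≤ n) : Subsingleton (Ext A Z i)

lemma mk₀_iso_comp_eq_zero_iff {A A' Z : C} (e : A ≅ A') {n : ℕ} (x : Ext A' Z n) :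
    (Ext.mk₀ e.hom).comp x (zero_add n) = 0 ↔ x = 0 := by
  refine ⟨fun h => ?_, fun h => by rw [h, Ext.comp_zero]⟩
  rw [← Ext.mk₀_id_comp x, ← e.inv_hom_id, ← Ext.mk₀_comp_mk₀_assoc, h, Ext.comp_zero]

lemma IsLinking.of_iso {A A' B B' Z : C} {n : ℕ} {η : Ext A B (n + 1)} {V : Set (B ⟶ Z)}
    (h : IsLinking η V) (a : A' ≅ A) (b : B ≅ B') :
    IsLinking ((Ext.mk₀ a.hom).comp (η.comp (Ext.mk₀ b.hom) (add_zero _)) (zero_add _))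
      {φ : B' ⟶ Z | b.hom ≫ φ ∈ V} := by
  have key {i m : ℕ} (hi : n + 1 + i = m) (y : Ext B' Z i) :
      ((Ext.mk₀ a.hom).comp (η.comp (Ext.mk₀ b.hom) (add_zero _)) (zero_add _)).comp y hi =
        (Ext.mk₀ a.hom).comp (η.comp ((Ext.mk₀ b.hom).comp y (zero_add _)) hi) (zero_add _) := by
    rw [← Ext.comp_assoc_of_second_deg_zero, Ext.comp_assoc _ _ _ (zero_add _) hi (by lia)]
  refine ⟨fun {i m} hi x => ?_, fun {i m} hi y hy => ?_, fun φ => ?_, fun i hi => ?_⟩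
  · obtain ⟨y, hy⟩ := h.exists_comp hi ((Ext.mk₀ a.inv).comp x (zero_add _))
    refine ⟨(Ext.mk₀ b.inv).comp y (zero_add _), ?_⟩
    rw [key, Ext.mk₀_comp_mk₀_assoc, b.hom_inv_id, Ext.mk₀_id_comp, hy, Ext.mk₀_comp_mk₀_assoc,
      a.hom_inv_id, Ext.mk₀_id_comp]
  · rw [key, mk₀_iso_comp_eq_zero_iff] at hy
    exact (mk₀_iso_comp_eq_zero_iff b y).mp (h.eq_zero hi _ hy)
  · rw [key, mk₀_iso_comp_eq_zero_iff, Ext.mk₀_comp_mk₀, h.comp_mk₀_eq_zero_iff]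
    rfl
  · exact subsingleton_ext_of_iso a (h.subsingleton i hi)

lemma eq_zero_of_extClass_comp {X : ShortComplex C} (hX : X.ShortExact) {Z : C} {n m : ℕ}
    (h : 1 + n = m) (h₂ : Subsingleton (Ext X.X₂ Z n)) (y : Ext X.X₁ Z n)
    (hy : hX.extClass.comp y h = 0) : y = 0 := by
  obtain ⟨z, rfl⟩ := Ext.contravariant_sequence_exact₁ hX Z y h hy
  rw [Subsingleton.elim z 0, Ext.comp_zero]

/-- This is the long exact sequence with the positive Ext groups of the middle term removed; V
consists of the maps that extend over X₂. -/
lemma isLinking_extClass {X : ShortComplex C} (hX : X.ShortExact) {Z : C}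
    (h₂ : ∀ i, Subsingleton (Ext X.X₂ Z (i + 1))) (h₃ : Subsingleton (Ext X.X₃ Z 0)) :
    IsLinking (n := 0) hX.extClass {φ : X.X₁ ⟶ Z | ∃ ψ : X.X₂ ⟶ Z, X.f ≫ ψ = φ} where
  exists_comp {i m} h x := by
    obtain rfl : m = i + 1 := by lia
    exact Ext.contravariant_sequence_exact₃ hX Z x (Subsingleton.elim _ _) h
  eq_zero h y hy := eq_zero_of_extClass_comp hX h (h₂ _) y hy
  comp_mk₀_eq_zero_iff := extClass_comp_mk₀_eq_zero_iff hX
  subsingleton i hi := by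
    obtain rfl : i = 0 := by lia
    exact h₃

/-- Splicing with X shifts degrees once more. As V is everything, Hom(X₃, Z) contributes nothing to
Ext^(n+1)(A, Z), which gives the one new vanishing degree. -/
lemma IsLinking.comp_extClass {X : ShortComplex C} (hX : X.ShortExact) {A Z : C} {n : ℕ}
    {η : Ext A X.X₃ (n + 1)} {V : Set (X.X₃ ⟶ Z)} (hη : IsLinking η V)
    (h₂ : ∀ i, Subsingleton (Ext X.X₂ Z (i + 1))) (hV : ∀ φ, φ ∈ V) :
    IsLinking (n := n + 1) (η.comp hX.extClass rfl)
      {φ : X.X₁ ⟶ Z | ∃ ψ : X.X₂ ⟶ Z, X.f ≫ ψ = φ} where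
  exists_comp {i m} h x := by
    obtain ⟨y, rfl⟩ := hη.exists_comp (i := i + 1) (by lia) x
    obtain ⟨z, rfl⟩ := Ext.contravariant_sequence_exact₃ hX Z y (Subsingleton.elim _ _)
      (add_comm 1 i)
    exact ⟨z, Ext.comp_assoc _ _ _ _ _ (by lia)⟩
  eq_zero {i m} h y hy := by
    rw [Ext.comp_assoc _ _ _ rfl (add_comm 1 (i + 1)) (by lia)] at hy
    exact eq_zero_of_extClass_comp hX _ (h₂ i) y (hη.eq_zero _ _ hy)
  comp_mk₀_eq_zero_iff φ := by
    rw [Ext.comp_assoc _ _ _ rfl (add_zero 1) (by lia)]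
    exact Iff.trans ⟨hη.eq_zero _ _, fun h => by rw [h, Ext.comp_zero]⟩
      (extClass_comp_mk₀_eq_zero_iff hX φ)
  subsingleton i hi := by
    obtain hi | rfl := Nat.le_succ_iff.mp hi
    · exact hη.subsingleton i hi
    · refine subsingleton_of_forall_eq 0 fun x => ?_
      obtain ⟨y, rfl⟩ := hη.exists_comp (add_zero (n + 1)) x
      obtain ⟨φ, rfl⟩ := Ext.addEquiv₀.symm.surjective y
      exact (hη.comp_mk₀_eq_zero_iff φ).mpr (hV φ)

end Linking

/-! ### The image Q of P* → K* and its two short exact sequences -/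

section DualImage

variable {R : Type u} (S : Type u) [Ring R] [Ring S] (T : Type u) [AddCommGroup T] [Module R T]
  [Module S T] [SMulCommClass S R T] (M : ModuleCat.{u} R) [Module.Finite R M]

/-- The image of the restriction map `Hom_R(P, T) ⟶ Hom_R(K, T)`, where `0 ⟶ K ⟶ P ⟶ M ⟶ 0` is the
chosen finite free cover of `M`. -/
noncomputable def dualImage : ModuleCat.{u} S :=
  Limits.kernel (extConnecting S T (shortExact_syzygyComplex M) 0)

/-- The inclusion of `dualImage S T M` into `Hom_R(K, T)`. -/
noncomputable def dualImageι : dualImage S T M ⟶ extObj R S T 0 (syzygy M) :=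
  Limits.kernel.ι (extConnecting S T (shortExact_syzygyComplex M) 0)

instance : Mono (dualImageι S T M) :=
  inferInstanceAs (Mono (Limits.kernel.ι (extConnecting S T (shortExact_syzygyComplex M) 0)))

lemma dualImageι_extConnecting :
    dualImageι S T M ≫ extConnecting S T (shortExact_syzygyComplex M) 0 = 0 :=
  Limits.kernel.condition _

/-- The projection of `Hom_R(P, T)` onto `dualImage S T M`. -/
noncomputable def dualImageπ : extObj R S T 0 (syzygyComplex M).X₂ ⟶ dualImage S T M :=
  Limits.kernel.lift _ (extMap S T 0 (syzygyComplex M).f)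
    (extMap_extConnecting S T (shortExact_syzygyComplex M) 0)

lemma dualImageπ_ι : dualImageπ S T M ≫ dualImageι S T M = extMap S T 0 (syzygyComplex M).f :=
  Limits.kernel.lift_ι _ _ _

lemma surjective_dualImageπ : Function.Surjective (dualImageπ S T M).hom := by
  intro q
  have hq := congrArg (fun f => f.hom q) (dualImageι_extConnecting S T M)
  obtain ⟨x, hx⟩ := (exact_extMap_extConnecting S T (shortExact_syzygyComplex M) 0
    ((dualImageι S T M).hom q)).mp hq
  refine ⟨x, (ModuleCat.mono_iff_injective (dualImageι S T M)).mp inferInstance ?_⟩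
  rw [← hx, ← dualImageπ_ι]
  rfl

/-- The short exact sequence `0 ⟶ dualImage S T M ⟶ Hom_R(K, T) ⟶ Ext^1_R(M, T) ⟶ 0`. -/
noncomputable abbrev dualImageComplex : ShortComplex (ModuleCat.{u} S) :=
  ShortComplex.mk (dualImageι S T M) (extConnecting S T (shortExact_syzygyComplex M) 0)
    (dualImageι_extConnecting S T M)

lemma shortExact_dualImageComplex : (dualImageComplex S T M).ShortExact where
  exact := ShortComplex.exact_kernel _
  mono_f := inferInstanceAs (Mono (dualImageι S T M))
  epi_g := (ModuleCat.epi_iff_surjective _).mpr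
    (surjective_extConnecting S T _ 0 (Ext.subsingleton_of_projective _ _ _))

/-- The short exact sequence `0 ⟶ Hom_R(M, T) ⟶ Hom_R(P, T) ⟶ dualImage S T M ⟶ 0`. -/
noncomputable abbrev dualCoverComplex : ShortComplex (ModuleCat.{u} S) :=
  ShortComplex.mk (extMap S T 0 (syzygyComplex M).g) (dualImageπ S T M) (by
    rw [← cancel_mono (dualImageι S T M), Category.assoc, dualImageπ_ι, Limits.zero_comp]
    exact (dualComplex S T (syzygyComplex M)).zero)

lemma shortExact_dualCoverComplex : (dualCoverComplex S T M).ShortExact := by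
  have := (shortExact_syzygyComplex M).epi_g
  refine ModuleCat.shortComplex_shortExact _ (fun x => ⟨fun hx => ?_, ?_⟩)
    (injective_extMap_zero S T (syzygyComplex M).g) (surjective_dualImageπ S T M)
  · refine (exact_extMap_extMap S T (shortExact_syzygyComplex M) 0 x).mp ?_
    rw [← dualImageπ_ι]
    exact (congrArg (dualImageι S T M).hom hx).trans (map_zero _)
  · rintro ⟨y, rfl⟩
    exact (dualCoverComplex S T M).moduleCat_zero_apply y

variable {S T M} {M' : ModuleCat.{u} R} [Module.Finite R M']

lemma exists_dualImage_map (F : syzygyComplex M ⟶ syzygyComplex M') :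
    ∃ q : dualImage S T M' ⟶ dualImage S T M,
      q ≫ dualImageι S T M = dualImageι S T M' ≫ extMap S T 0 F.τ₁ := by
  have h : (dualImageι S T M' ≫ extMap S T 0 F.τ₁) ≫
      extConnecting S T (shortExact_syzygyComplex M) 0 = 0 := by
    rw [Category.assoc, extConnecting_naturality _ _ _ (shortExact_syzygyComplex M'),
      ← Category.assoc, dualImageι_extConnecting, Limits.zero_comp]
  exact ⟨Limits.kernel.lift _ _ h, Limits.kernel.lift_ι _ _ h⟩

lemma dualImageπ_naturality (F : syzygyComplex M ⟶ syzygyComplex M')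
    {q : dualImage S T M' ⟶ dualImage S T M}
    (hq : q ≫ dualImageι S T M = dualImageι S T M' ≫ extMap S T 0 F.τ₁) :
    dualImageπ S T M' ≫ q = extMap S T 0 F.τ₂ ≫ dualImageπ S T M := by
  rw [← cancel_mono (dualImageι S T M), Category.assoc, hq, ← Category.assoc, dualImageπ_ι,
    Category.assoc, dualImageπ_ι, ← extMap_comp, ← extMap_comp, F.comm₁₂]

end DualImage

/-! ### Construction of the natural linking classes -/

section LinkingClass

variable (R S : Type u) [Ring R] [Ring S] (T : Type u) [AddCommGroup T] [Module R T] [Module S T]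
  [SMulCommClass S R T]

/-- The only positive degree in which `Ext_R(M, T)` may be nonzero is `n + 1`. -/
def PosExtConcentrated (n : ℕ) (M : ModuleCat.{u} R) : Prop :=
  ∀ i, i ≠ n → Subsingleton (Ext M (ModuleCat.of R T) (i + 1))

variable {R} in
/-- The maps `dualImage S T M ⟶ T` given by evaluation at elements of the syzygy of `M`. -/
def syzygyEvals (M : ModuleCat.{u} R) [Module.Finite R M] :
    Set (dualImage S T M ⟶ ModuleCat.of S T) :=
  Set.range fun k : syzygy M => dualImageι S T M ≫ evalHom S T k

variable {R S T}

lemma PosExtConcentrated.syzygy {n : ℕ} {M : ModuleCat.{u} R} [Module.Finite R M]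
    (h : PosExtConcentrated R T (n + 1) M) : PosExtConcentrated R T n (syzygy M) :=
  fun i hi => subsingleton_ext_syzygy M i (h (i + 1) (by lia))

variable (H : DualityContext R S T)

include H

lemma DualityContext.eq_zero_of_evalHom_syzygy (M : ModuleCat.{u} R) [Module.Finite R M]
    (k : syzygy M) (hk : evalHom S T ((syzygyComplex M).f.hom k) = 0) : k = 0 :=
  Subtype.ext ((H.isReflexiveAcyclic_cover M).eq_zero_of_evalHom _ hk)

/-- The syzygy K is acyclic, so K* is acyclic with Hom(K*, T) = K, and 0 → Q → K* → Ext^1(M, T) → 0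
gives the class. A map Ext^1(M, T) → T pulls back to evaluation at a k in K that vanishes on the
functionals coming from P, so k = 0. -/
lemma DualityContext.isLinking_zero (M : ModuleCat.{u} R) [Module.FinitePresentation R M]
    (hM : PosExtConcentrated R T 0 M) :
    IsLinking (n := 0) (shortExact_dualImageComplex S T M).extClass (syzygyEvals S T M) := by
  have := H.coherent.finitePresentation_syzygy M
  have hK := H.isReflexiveAcyclic_of_acyclic (syzygy M)
    (fun n => subsingleton_ext_syzygy M n (hM (n + 1) (by lia)))
  have hV : syzygyEvals S T M = {φ | ∃ ψ, dualImageι S T M ≫ ψ = φ} := by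
    ext φ
    constructor
    · rintro ⟨k, rfl⟩
      exact ⟨_, rfl⟩
    · rintro ⟨ψ, rfl⟩
      obtain ⟨k, rfl⟩ := hK.exists_evalHom ψ
      exact ⟨k, rfl⟩
  rw [hV]
  refine isLinking_extClass (shortExact_dualImageComplex S T M) hK.subsingleton_ext_dual ?_
  refine subsingleton_of_forall_eq 0 fun x => ?_
  obtain ⟨φ, rfl⟩ := Ext.addEquiv₀.symm.surjective x
  have := (shortExact_dualImageComplex S T M).epi_g
  obtain ⟨k, hk⟩ := hK.exists_evalHom ((dualImageComplex S T M).g ≫ φ)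
  have hk0 : k = 0 := by
    apply H.eq_zero_of_evalHom_syzygy
    rw [← extMap_evalHom, hk, ← Category.assoc]
    exact (congrArg (· ≫ φ) (extMap_extConnecting S T (shortExact_syzygyComplex M) 0)).trans
      Limits.zero_comp
  have hφ : φ = 0 := by
    rw [← cancel_epi (dualImageComplex S T M).g, ← hk, hk0, evalHom_zero, Limits.comp_zero]
  rw [hφ, map_zero]

/-- A map from the image of P₁* → K₁*, where 0 → K₁ → P₁ → K → 0, pulls back to evaluation at some p
in P₁ that kills K*. As K lies in a reflexive free module, p maps to zero in K, so p is in K₁. -/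
lemma DualityContext.mem_syzygyEvals_syzygy (M : ModuleCat.{u} R) [Module.FinitePresentation R M]
    [Module.Finite R (syzygy M)]
    (φ : dualImage S T (syzygy M) ⟶ ModuleCat.of S T) : φ ∈ syzygyEvals S T (syzygy M) := by
  obtain ⟨p, hp⟩ :=
    (H.isReflexiveAcyclic_cover (syzygy M)).exists_evalHom (dualImageπ S T (syzygy M) ≫ φ)
  have hπp : (syzygyComplex (syzygy M)).g.hom p = 0 := by
    apply H.eq_zero_of_evalHom_syzygy
    rw [← extMap_evalHom, ← extMap_evalHom, hp, ← Category.assoc (extMap S T 0 _)]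
    have := (dualCoverComplex S T (syzygy M)).zero
    exact (congrArg (extMap S T 0 (syzygyComplex M).f ≫ · ≫ φ) this).trans (by simp)
  have := (shortExact_dualCoverComplex S T (syzygy M)).epi_g
  refine ⟨⟨p, hπp⟩, ?_⟩
  rw [← cancel_epi (dualCoverComplex S T (syzygy M)).g]
  change dualImageπ S T (syzygy M) ≫ dualImageι S T (syzygy M) ≫ _ = dualImageπ S T (syzygy M) ≫ _
  rw [← Category.assoc, dualImageπ_ι, extMap_evalHom, ← hp]
  rfl

omit H in
lemma isIso_dualImageι (M : ModuleCat.{u} R) [Module.Finite R M]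
    (hM : Subsingleton (Ext M (ModuleCat.of R T) 1)) : IsIso (dualImageι S T M) := by
  have hzero : extConnecting S T (shortExact_syzygyComplex M) 0 = 0 := by
    ext x
    exact hM.elim _ _
  have : Epi (dualImageι S T M) :=
    (shortExact_dualImageComplex S T M).exact.epi_f hzero
  exact isIso_of_mono_of_epi _

omit H in
lemma isIso_extConnecting (M : ModuleCat.{u} R) [Module.Finite R M] (n : ℕ) :
    IsIso (extConnecting S T (shortExact_syzygyComplex M) (n + 1)) :=
  (ConcreteCategory.isIso_iff_bijective _).mpr
    ⟨injective_extConnecting S T _ _ (Ext.subsingleton_of_projective _ _ _),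
      surjective_extConnecting S T _ _ (Ext.subsingleton_of_projective _ _ _)⟩

/-- The class for K is spliced with 0 → K* → P₁* → Q(K) → 0 and transported along the isomorphisms
`a` and `b`. Maps K* → T that extend over P₁* are exactly evaluations at elements of K, since P₁ is
reflexive and covers K. -/
lemma DualityContext.isLinking_succ {n : ℕ} (M : ModuleCat.{u} R) [Module.FinitePresentation R M]
    [Module.Finite R (syzygy M)]
    {η : Ext (extObj R S T (n + 1) (syzygy M)) (dualImage S T (syzygy M)) (n + 1)}
    (hη : IsLinking η (syzygyEvals S T (syzygy M)))
    (a : extObj R S T (n + 2) M ≅ extObj R S T (n + 1) (syzygy M))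
    (b : extObj R S T 0 (syzygy M) ≅ dualImage S T M) (hb : b.inv = dualImageι S T M) :
    IsLinking (n := n + 1)
      ((Ext.mk₀ a.hom).comp ((η.comp (shortExact_dualCoverComplex S T (syzygy M)).extClass
        rfl).comp (Ext.mk₀ b.hom) (add_zero (n + 2))) (zero_add (n + 2)))
      (syzygyEvals S T M) := by
  have h := ((hη.comp_extClass (shortExact_dualCoverComplex S T (syzygy M))
    (H.isReflexiveAcyclic_cover (syzygy M)).subsingleton_ext_dual
    (H.mem_syzygyEvals_syzygy M)).of_iso a b)
  convert h using 1
  ext φ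
  constructor
  · rintro ⟨k, rfl⟩
    obtain ⟨p, rfl⟩ := (shortExact_syzygyComplex (syzygy M)).moduleCat_surjective_g k
    refine ⟨evalHom S T p, ?_⟩
    rw [← hb, Iso.hom_inv_id_assoc]
    exact extMap_evalHom S T (syzygyComplex (syzygy M)).g p
  · rintro ⟨ψ, hψ⟩
    obtain ⟨p, rfl⟩ := (H.isReflexiveAcyclic_cover (syzygy M)).exists_evalHom ψ
    refine ⟨(syzygyComplex (syzygy M)).g.hom p, ?_⟩
    change dualImageι S T M ≫ _ = _
    rw [← extMap_evalHom, ← hb, Iso.inv_comp_eq]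
    exact hψ

/-- Natural linking classes in `Ext^(n+1)(Ext^(n+1)(M, T), dualImage S T M)`. -/
theorem DualityContext.exists_linking (n : ℕ) :
    ∃ η : ∀ (M : ModuleCat.{u} R) [Module.FinitePresentation R M],
        PosExtConcentrated R T n M → Ext (extObj R S T (n + 1) M) (dualImage S T M) (n + 1),
      (∀ (M : ModuleCat.{u} R) [Module.FinitePresentation R M] (h : PosExtConcentrated R T n M),
        IsLinking (η M h) (syzygyEvals S T M)) ∧
      ∀ (M M' : ModuleCat.{u} R) [Module.FinitePresentation R M] [Module.FinitePresentation R M']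
        (h : PosExtConcentrated R T n M) (h' : PosExtConcentrated R T n M')
        (F : syzygyComplex M ⟶ syzygyComplex M') (q : dualImage S T M' ⟶ dualImage S T M),
        q ≫ dualImageι S T M = dualImageι S T M' ≫ extMap S T 0 F.τ₁ →
        (Ext.mk₀ (extMap S T (n + 1) F.τ₃)).comp (η M h) (zero_add _) =
          (η M' h').comp (Ext.mk₀ q) (add_zero _) := by
  induction n with
  | zero =>
    refine ⟨fun M _ _ => (shortExact_dualImageComplex S T M).extClass,
      fun M _ h => H.isLinking_zero M h, fun M M' _ _ h h' F q hq => ?_⟩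
    exact ((shortExact_dualImageComplex S T M').extClass_naturality
      (shortExact_dualImageComplex S T M)
      { τ₁ := q
        τ₂ := extMap S T 0 F.τ₁
        τ₃ := extMap S T 1 F.τ₃
        comm₁₂ := hq
        comm₂₃ := extConnecting_naturality S T _ _ F 0 }).symm
  | succ n ih =>
    obtain ⟨η, hη, hnat⟩ := ih
    have hfp (M : ModuleCat.{u} R) [Module.FinitePresentation R M] :=
      H.coherent.finitePresentation_syzygy M
    have hι (M : ModuleCat.{u} R) [Module.FinitePresentation R M]
        (h : PosExtConcentrated R T (n + 1) M) : IsIso (dualImageι S T M) :=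
      isIso_dualImageι M (h 0 (by lia))
    have hδ (M : ModuleCat.{u} R) [Module.FinitePresentation R M] :=
      isIso_extConnecting (S := S) (T := T) M n
    refine ⟨fun M _ h =>
      (Ext.mk₀ (asIso (extConnecting S T (shortExact_syzygyComplex M) (n + 1))).symm.hom).comp
        (((η (syzygy M) h.syzygy).comp
          (shortExact_dualCoverComplex S T (syzygy M)).extClass rfl).comp
            (Ext.mk₀ (@asIso _ _ _ _ _ (hι M h)).symm.hom) (add_zero (n + 2))) (zero_add (n + 2)),
      fun M _ h => H.isLinking_succ M (hη (syzygy M) h.syzygy) _ _ rfl,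
      fun M M' _ _ h h' F q hq => ?_⟩
    have := hι M h
    have := hι M' h'
    -- The splice involves the cover of the syzygy, so the map on syzygies has to be lifted one
    -- level further.
    obtain ⟨G, hG⟩ := exists_syzygyComplex_map F.τ₁
    obtain ⟨q', hq'⟩ := exists_dualImage_map (S := S) (T := T) G
    refine comp_naturality _ (b := extMap S T (n + 1) F.τ₁) ?_
      (comp_naturality _ (b := extMap S T 0 F.τ₁) (comp_naturality _ (b := q') ?_ ?_) ?_)
    · refine mk₀_naturality ?_
      rw [Iso.symm_hom, Iso.symm_hom, Iso.comp_inv_eq, Category.assoc, Iso.eq_inv_comp]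
      exact (extConnecting_naturality S T _ _ F (n + 1)).symm
    · have := hnat (syzygy M) (syzygy M') h.syzygy h'.syzygy G q' hq'
      rwa [hG] at this
    · exact ((shortExact_dualCoverComplex S T (syzygy M')).extClass_naturality
        (shortExact_dualCoverComplex S T (syzygy M))
        { τ₁ := extMap S T 0 F.τ₁
          τ₂ := extMap S T 0 G.τ₂
          τ₃ := q'
          comm₁₂ := by
            rw [← extMap_comp, ← extMap_comp, ← hG, G.comm₂₃]
          comm₂₃ := (dualImageπ_naturality G hq').symm }).symm
    · refine mk₀_naturality ?_
      rw [Iso.symm_hom, Iso.symm_hom, Iso.comp_inv_eq, Category.assoc, Iso.eq_inv_comp]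
      exact hq.symm

end LinkingClass

/-! ### The double-dual isomorphism in natural degrees -/

section DoubleDual

variable {R S : Type u} [Ring R] [Ring S] {T : Type u} [AddCommGroup T] [Module R T] [Module S T]
  [SMulCommClass S R T] [SMulCommClass R S T]

/-- The map `P ⟶ Ext^n_S(A, T)` which sends `p` to the composition of a class
`ζ : Ext^n_S(A, Hom_R(P, T))` with the evaluation at `p`. -/
noncomputable def evalClass {A : ModuleCat.{u} S} {P : ModuleCat.{u} R} {n : ℕ}
    (ζ : Ext A (extObj R S T 0 P) n) : P ⟶ extObj S R T n A :=
  letI := extModule S R T A n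
  ModuleCat.ofHom (Y := Ext A (ModuleCat.of S T) n)
    { toFun := fun p => ζ.comp (Ext.mk₀ (evalHom S T p)) (add_zero n)
      map_add' := fun p p' => by rw [evalHom_add, Ext.mk₀_add, Ext.comp_add]
      map_smul' := fun r p => by
        rw [evalHom_smul, ← Ext.mk₀_comp_mk₀, ← Ext.comp_assoc_of_third_deg_zero]
        rfl }

lemma evalClass_apply {A : ModuleCat.{u} S} {P : ModuleCat.{u} R} {n : ℕ}
    (ζ : Ext A (extObj R S T 0 P) n) (p : P) :
    (evalClass ζ).hom p = ζ.comp (Ext.mk₀ (evalHom S T p)) (add_zero n) := rfl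

lemma evalClass_naturality {A A' : ModuleCat.{u} S} {P P' : ModuleCat.{u} R} {n : ℕ}
    {ζ : Ext A (extObj R S T 0 P) n} {ζ' : Ext A' (extObj R S T 0 P') n} {a : A' ⟶ A} {f : P ⟶ P'}
    (h : (Ext.mk₀ a).comp ζ (zero_add n) = ζ'.comp (Ext.mk₀ (extMap S T 0 f)) (add_zero n)) :
    f ≫ evalClass ζ' = evalClass ζ ≫ extMap R T n a := by
  ext p
  change ζ'.comp (Ext.mk₀ (evalHom S T (f.hom p))) (add_zero n) =
    (Ext.mk₀ a).comp (ζ.comp (Ext.mk₀ (evalHom S T p)) (add_zero n)) (zero_add n)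
  rw [← Ext.comp_assoc _ _ _ (zero_add n) (add_zero n) (by lia), h, ← extMap_evalHom,
    ← Ext.mk₀_comp_mk₀, Ext.comp_assoc_of_third_deg_zero]

variable (R T) in
/-- The `R`-module `M` is finitely presented and `Ext_R(M, T)` is concentrated in degree `n`. -/
structure NatExtConcentrated (n : ℕ) (M : ModuleCat.{u} R) : Prop where
  finitePresentation : Module.FinitePresentation R M
  subsingleton (i : ℕ) (hi : i ≠ n) : Subsingleton (Ext M (ModuleCat.of R T) i)

variable (R S T) in
/-- For modules with `Ext` concentrated in degree `n`, the functor `Ext^n_R(-, T)` preserves this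
property and there is a natural isomorphism with the double dual. -/
def HasNatDuality (n : ℕ) : Prop :=
  (∀ M, NatExtConcentrated R T n M → NatExtConcentrated S T n (extObj R S T n M)) ∧
    ∃ φ : ∀ M, NatExtConcentrated R T n M → (M ⟶ extObj S R T n (extObj R S T n M)),
      (∀ M h, IsIso (φ M h)) ∧
      ∀ (M M' : ModuleCat.{u} R) (h : NatExtConcentrated R T n M)
        (h' : NatExtConcentrated R T n M') (f : M ⟶ M'),
        f ≫ φ M' h' = φ M h ≫ extMap R T n (extMap S T n f)

lemma DualityContext.hasNatDuality_zero (H : DualityContext R S T) : HasNatDuality R S T 0 := by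
  have hRA (M : ModuleCat.{u} R) (h : NatExtConcentrated R T 0 M) : IsReflexiveAcyclic R S T M :=
    have := h.finitePresentation
    H.isReflexiveAcyclic_of_acyclic M fun n => h.subsingleton (n + 1) (by lia)
  -- The identity class of M* yields the usual biduality map, sending m to evaluation at m.
  refine ⟨fun M h => ⟨?_, fun i hi => ?_⟩, fun M _ => evalClass (Ext.mk₀ (𝟙 _)), fun M h => ?_,
    fun M M' h h' f => evalClass_naturality (mk₀_naturality (by simp))⟩
  · have := h.finitePresentation
    exact H.finitePresentation_extObj 0 M
  · obtain ⟨j, rfl⟩ := Nat.exists_eq_succ_of_ne_zero hi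
    exact (hRA M h).subsingleton_ext_dual j
  · refine (ConcreteCategory.isIso_iff_bijective _).mpr ⟨?_, fun x => ?_⟩
    · refine (injective_iff_map_eq_zero (evalClass (R := R) (Ext.mk₀ (𝟙 _))).hom).mpr fun m hm => ?_
      rw [evalClass_apply, Ext.mk₀_id_comp] at hm
      exact (hRA M h).eq_zero_of_evalHom m ((Ext.mk₀_eq_zero_iff _).mp hm)
    · obtain ⟨a, rfl⟩ := Ext.addEquiv₀.symm.surjective x
      obtain ⟨m, rfl⟩ := (hRA M h).exists_evalHom a
      exact ⟨m, Ext.mk₀_id_comp _⟩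

omit [SMulCommClass R S T] in
lemma isIso_dualImageπ (M : ModuleCat.{u} R) [Module.Finite R M]
    (hM : Subsingleton (Ext M (ModuleCat.of R T) 0)) : IsIso (dualImageπ S T M) := by
  have hD := shortExact_dualCoverComplex S T M
  have hzero : (dualCoverComplex S T M).f = 0 := by
    ext x
    have : x = 0 := hM.elim _ _
    rw [this, map_zero, map_zero]
  have : Mono (dualImageπ S T M) := hD.exact.mono_g hzero
  have : Epi (dualImageπ S T M) := hD.epi_g
  exact isIso_of_mono_of_epi _

/-- Vanishing of M* makes P* → Q an isomorphism, so the linking class becomes a class ζ with values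
in P*. Composing ζ with evaluations gives a surjection P → Ext^(n+1)(Ext^(n+1)(M, T), T) with kernel
K, hence the isomorphism from M. -/
lemma DualityContext.hasNatDuality_succ (H : DualityContext R S T) (n : ℕ) :
    HasNatDuality R S T (n + 1) := by
  obtain ⟨η, hη, hnat⟩ := H.exists_linking n
  have hpos (M : ModuleCat.{u} R) (h : NatExtConcentrated R T (n + 1) M) :
      PosExtConcentrated R T n M := fun i hi => h.subsingleton (i + 1) (by lia)
  have hπ (M : ModuleCat.{u} R) (h : NatExtConcentrated R T (n + 1) M) :
      have := h.finitePresentation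
      IsIso (dualImageπ S T M) :=
    have := h.finitePresentation
    isIso_dualImageπ M (h.subsingleton 0 (by lia))
  let ζ (M : ModuleCat.{u} R) (h : NatExtConcentrated R T (n + 1) M) :
      haveI := h.finitePresentation
      Ext (extObj R S T (n + 1) M) (extObj R S T 0 (syzygyComplex M).X₂) (n + 1) :=
    have := h.finitePresentation
    have := hπ M h
    (η M (hpos M h)).comp (Ext.mk₀ (inv (dualImageπ S T M))) (add_zero (n + 1))
  -- The linking class kills precisely the evaluations at elements of K, and evaluation on P*
  -- determines p by reflexivity of P.
  have hζ (M : ModuleCat.{u} R) (h : NatExtConcentrated R T (n + 1) M) :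
      have := h.finitePresentation
      ∀ p, (evalClass (ζ M h)).hom p = 0 ↔ (syzygyComplex M).g.hom p = 0 := by
    intro _ p
    have := hπ M h
    have key : (evalClass (ζ M h)).hom p = 0 ↔
        inv (dualImageπ S T M) ≫ evalHom S T p ∈ syzygyEvals S T M := by
      rw [← (hη M (hpos M h)).comp_mk₀_eq_zero_iff, evalClass_apply,
        ← Ext.mk₀_comp_mk₀, ← Ext.comp_assoc_of_third_deg_zero]
      rfl
    rw [key]
    constructor
    · rintro ⟨k, hk⟩
      have hpk : evalHom S T ((syzygyComplex M).f.hom k) = evalHom S T p := by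
        rw [← extMap_evalHom, ← dualImageπ_ι, Category.assoc]
        exact ((IsIso.eq_inv_comp _).mp hk)
      rw [← (H.isReflexiveAcyclic_cover M).eq_of_evalHom hpk]
      exact k.2
    · intro hp
      refine ⟨⟨p, hp⟩, ?_⟩
      change dualImageι S T M ≫ _ = _
      rw [IsIso.eq_inv_comp, ← Category.assoc, dualImageπ_ι, extMap_evalHom]
      rfl
  have hζ0 (M : ModuleCat.{u} R) (h : NatExtConcentrated R T (n + 1) M) :
      have := h.finitePresentation
      (syzygyComplex M).f ≫ evalClass (ζ M h) = 0 := by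
    intro _
    ext k
    exact (hζ M h _).mpr k.2
  have hepi (M : ModuleCat.{u} R) (h : NatExtConcentrated R T (n + 1) M) :
      have := h.finitePresentation
      Epi (syzygyComplex M).g :=
    have := h.finitePresentation
    (shortExact_syzygyComplex M).epi_g
  refine ⟨fun M h => ⟨?_, fun i hi => ?_⟩, fun M h =>
    have := h.finitePresentation
    have := hepi M h
    (shortExact_syzygyComplex M).exact.desc _ (hζ0 M h), fun M h => ?_, fun M M' h h' f => ?_⟩
  · have := h.finitePresentation
    exact H.finitePresentation_extObj (n + 1) M
  · have := h.finitePresentation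
    have := hπ M h
    obtain hi' | hi' := Nat.lt_or_gt_of_ne hi
    · exact (hη M (hpos M h)).subsingleton i (by lia)
    · obtain ⟨j, hj⟩ : ∃ j, n + 1 + (j + 1) = i := ⟨i - (n + 2), by lia⟩
      refine subsingleton_of_forall_eq 0 fun x => ?_
      obtain ⟨y, rfl⟩ := (hη M (hpos M h)).exists_comp hj x
      have : Subsingleton (Ext (dualImage S T M) (ModuleCat.of S T) (j + 1)) :=
        subsingleton_ext_of_iso (asIso (dualImageπ S T M)).symm
          ((H.isReflexiveAcyclic_cover M).subsingleton_ext_dual j)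
      rw [Subsingleton.elim y 0, Ext.comp_zero]
  · have := h.finitePresentation
    have := hepi M h
    have hdesc (p) : ((shortExact_syzygyComplex M).exact.desc _ (hζ0 M h)).hom
        ((syzygyComplex M).g.hom p) = (evalClass (ζ M h)).hom p :=
      congrArg (fun f => f.hom p) ((shortExact_syzygyComplex M).exact.g_desc _ (hζ0 M h))
    refine (ConcreteCategory.isIso_iff_bijective _).mpr ⟨?_, fun x => ?_⟩
    · refine (injective_iff_map_eq_zero
        ((shortExact_syzygyComplex M).exact.desc _ (hζ0 M h)).hom).mpr fun m hm => ?_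
      obtain ⟨p, rfl⟩ := surjective_coverMap M m
      exact (hζ M h p).mp ((hdesc p).symm.trans hm)
    · have := hπ M h
      obtain ⟨y, hy⟩ := (hη M (hpos M h)).exists_comp (add_zero (n + 1)) x
      obtain ⟨a, rfl⟩ := Ext.addEquiv₀.symm.surjective y
      obtain ⟨p, hp⟩ := (H.isReflexiveAcyclic_cover M).exists_evalHom (dualImageπ S T M ≫ a)
      refine ⟨(syzygyComplex M).g.hom p, (hdesc p).trans (Eq.trans ?_ hy)⟩
      rw [evalClass_apply, hp, Ext.comp_assoc_of_third_deg_zero, Ext.mk₀_comp_mk₀,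
        IsIso.inv_hom_id_assoc]
      rfl
  · have := h.finitePresentation
    have := h'.finitePresentation
    have := hepi M h
    have := hepi M' h'
    have := hπ M h
    have := hπ M' h'
    obtain ⟨F, rfl⟩ := exists_syzygyComplex_map f
    obtain ⟨q, hq⟩ := exists_dualImage_map (S := S) (T := T) F
    rw [← cancel_epi (syzygyComplex M).g, ← Category.assoc, ← Category.assoc,
      ShortComplex.Exact.g_desc]
    have hg : (syzygyComplex M).g ≫ F.τ₃ = F.τ₂ ≫ (syzygyComplex M').g := F.comm₂₃.symm
    rw [hg, Category.assoc, ShortComplex.Exact.g_desc]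
    refine evalClass_naturality (comp_naturality _ (hnat M M' (hpos M h) (hpos M' h') F q hq)
      (mk₀_naturality ?_))
    rw [IsIso.comp_inv_eq, Category.assoc, IsIso.eq_inv_comp]
    exact dualImageπ_naturality F hq

theorem DualityContext.hasNatDuality (H : DualityContext R S T) (n : ℕ) :
    HasNatDuality R S T n := by
  cases n with
  | zero => exact H.hasNatDuality_zero
  | succ n => exact H.hasNatDuality_succ n

end DoubleDual

/-! ### Integer degrees, including the negative ones -/

section IntDegrees

variable {R S : Type u} [Ring R] [Ring S] {T : Type u} [AddCommGroup T] [Module R T] [Module S T]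
  [SMulCommClass S R T]

lemma isZero_extInt_natCast_iff (n : ℕ) (M : ModuleCat.{u} R) :
    Limits.IsZero ((extInt R S T (Int.ofNat n)).obj (op M)) ↔
      Subsingleton (Ext M (ModuleCat.of R T) n) :=
  ModuleCat.isZero_iff_subsingleton (M := extObj R S T n M)

lemma isZero_extInt_negSucc (n : ℕ) (M : ModuleCat.{u} R) :
    Limits.IsZero ((extInt R S T (Int.negSucc n)).obj (op M)) :=
  ModuleCat.isZero_of_subsingleton (ModuleCat.of S PUnit.{u + 1})

lemma extConcentrated_natCast_iff (n : ℕ) (M : ModuleCat.{u} R) :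
    extConcentrated R S T (Int.ofNat n) M ↔ NatExtConcentrated R T n M := by
  refine ⟨fun h => ⟨h.1, fun i hi => ?_⟩, fun h => ⟨h.finitePresentation, fun i hi => ?_⟩⟩
  · exact (isZero_extInt_natCast_iff i M).mp (h.2 (Int.ofNat i) (by simpa using hi))
  · cases i with
    | ofNat i =>
      exact (isZero_extInt_natCast_iff i M).mpr
        (h.subsingleton i fun hin => hi (congrArg Int.ofNat hin))
    | negSucc i => exact isZero_extInt_negSucc i M

/-- Concentration in a negative degree kills every Ext group; M is then acyclic, hence reflexive,
with M* = 0. -/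
lemma DualityContext.isZero_of_extConcentrated_negSucc (H : DualityContext R S T) {n : ℕ}
    {M : ModuleCat.{u} R} (h : extConcentrated R S T (Int.negSucc n) M) : Limits.IsZero M := by
  have hM (i : ℕ) : Subsingleton (Ext M (ModuleCat.of R T) i) :=
    (isZero_extInt_natCast_iff (S := S) i M).mp (h.2 (Int.ofNat i) (by simp))
  have := h.1
  have hRA := H.isReflexiveAcyclic_of_acyclic M fun i => hM (i + 1)
  have h0 : Limits.IsZero (extObj R S T 0 M) := ModuleCat.isZero_iff_subsingleton.mpr (hM 0)
  have : Subsingleton M :=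
    subsingleton_of_forall_eq 0 fun m => hRA.eq_zero_of_evalHom m (h0.eq_of_src _ _)
  exact ModuleCat.isZero_of_subsingleton M

lemma extConcentrated_of_isZero (ℓ : ℤ) {M : ModuleCat.{u} R} (h : Limits.IsZero M) :
    extConcentrated R S T ℓ M := by
  have := ModuleCat.subsingleton_of_isZero h
  refine ⟨inferInstance, fun i _ => ?_⟩
  cases i with
  | ofNat i => exact (isZero_extInt_natCast_iff i M).mpr (subsingleton_ext_of_isZero h _ _)
  | negSucc i => exact isZero_extInt_negSucc i M

variable [SMulCommClass R S T]

theorem DualityContext.exists_doubleDual (H : DualityContext R S T) (ℓ : ℤ) :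
    (∀ M, extConcentrated R S T ℓ M →
      extConcentrated S R T ℓ ((extInt R S T ℓ).obj (op M))) ∧
    ∃ φ : ∀ M, extConcentrated R S T ℓ M →
        (M ⟶ (extInt S R T ℓ).obj (op ((extInt R S T ℓ).obj (op M)))),
      (∀ M h, IsIso (φ M h)) ∧
      ∀ (M M' : ModuleCat.{u} R) (h : extConcentrated R S T ℓ M)
        (h' : extConcentrated R S T ℓ M') (f : M ⟶ M'),
        f ≫ φ M' h' = φ M h ≫ (extInt S R T ℓ).map ((extInt R S T ℓ).map f.op).op := by
  cases ℓ with
  | ofNat n =>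
    obtain ⟨hconc, φ, hφ, hnat⟩ := H.hasNatDuality n
    exact ⟨fun M h => (extConcentrated_natCast_iff n _).mpr
        (hconc M ((extConcentrated_natCast_iff n M).mp h)),
      fun M h => φ M ((extConcentrated_natCast_iff n M).mp h), fun M h => hφ M _,
      fun M M' h h' f => hnat M M' _ _ f⟩
  | negSucc n =>
    refine ⟨fun M h => extConcentrated_of_isZero _ (isZero_extInt_negSucc n M), fun M h => 0,
      fun M h => ?_, fun M M' h h' f => by rw [Limits.comp_zero, Limits.zero_comp]⟩
    exact Limits.isIso_of_source_target_iso_zero _ (H.isZero_of_extConcentrated_negSucc h).isoZero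
      (isZero_extInt_negSucc n _).isoZero

end IntDegrees

/-! ### From the tilting hypotheses to the one-sided ones -/

lemma HasFinGenProjectiveResolution.finitePresentation {R : Type u} [Ring R]
    {T : Type u} [AddCommGroup T] [Module R T]
    (h : HasFinGenProjectiveResolution R T) : Module.FinitePresentation R T := by
  obtain ⟨P, hP⟩ := h
  have := hP 0
  have := hP 1
  have : Module.Projective R (P.complex.X 0) := inferInstance
  have : Module.FinitePresentation R (P.complex.X 0) :=
    Module.finitePresentation_of_projective R _
  exact finitePresentation_of_exact (P.complex.d 1 0).hom (P.π.f 0).hom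
    ((ShortComplex.ShortExact.moduleCat_exact_iff_function_exact _).mp P.exact₀)
    ((ModuleCat.epi_iff_surjective (P.π.f 0)).mp inferInstance)

lemma exists_subsingleton_ext_of_injectiveDimension_ne_top {S : Type u} [Ring S]
    (X : ModuleCat.{u} S) (h : injectiveDimension X ≠ ⊤) :
    ∃ d : ℕ, ∀ i, d ≤ i → ∀ N : ModuleCat.{u} S, Subsingleton (Ext N X i) := by
  obtain ⟨n, hn⟩ := (injectiveDimension_ne_top_iff X).mp h
  exact ⟨n + 1, fun i hi N => HasInjectiveDimensionLT.subsingleton X (n + 1) i hi N⟩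

end WakamatsuDuality

/-- Wakamatsu's duality: for every integer `ℓ`, the functors `Ext^ℓ_Γ(-, T)` and
`Ext^ℓ_{Λᵐᵒᵖ}(-, T)` restrict to the two full subcategories and form an adjoint equivalence. -/
theorem corollary4p3 (Γ Λ : Type u) [Ring Γ] [Ring Λ]
    (T : Type u) [AddCommGroup T] [Module Γ T] [Module Λᵐᵒᵖ T]
    [SMulCommClass Γ Λᵐᵒᵖ T] [SMulCommClass Λᵐᵒᵖ Γ T]
    (hΓ : IsLeftCoherent Γ) (hΛ : IsRightCoherent Λ)
    (hT : IsWakamatsuTilting Γ Λ T)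
    (hidΓ : injectiveDimension (ModuleCat.of Γ T) ≠ ⊤)
    (hidΛ : injectiveDimension (ModuleCat.of Λᵐᵒᵖ T) ≠ ⊤)
    (ℓ : ℤ) :
    ∃ (hF : ∀ M : ModuleCat.{u} Γ, extConcentrated Γ Λᵐᵒᵖ T ℓ M →
        extConcentrated Λᵐᵒᵖ Γ T ℓ ((extInt Γ Λᵐᵒᵖ T ℓ).obj (Opposite.op M)))
      (hG : ∀ N : ModuleCat.{u} Λᵐᵒᵖ, extConcentrated Λᵐᵒᵖ Γ T ℓ N →
        extConcentrated Γ Λᵐᵒᵖ T ℓ ((extInt Λᵐᵒᵖ Γ T ℓ).obj (Opposite.op N)))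
      (adj : (extRestrict Γ Λᵐᵒᵖ T ℓ hF).rightOp ⊣ extRestrict Λᵐᵒᵖ Γ T ℓ hG),
      IsIso adj.unit ∧ IsIso adj.counit := by
  have H : DualityContext Γ Λᵐᵒᵖ T :=
    { coherent := hΓ
      coherent' := hΛ
      finitePresentation := hT.resolution_right.finitePresentation
      isReflexiveAcyclic := isReflexiveAcyclic_self hT.ext_right hT.end_right
      exists_bound := exists_subsingleton_ext_of_injectiveDimension_ne_top _ hidΛ }
  have H' : DualityContext Λᵐᵒᵖ Γ T :=
    { coherent := hΛ
      coherent' := hΓ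
      finitePresentation := hT.resolution_left.finitePresentation
      isReflexiveAcyclic := isReflexiveAcyclic_self hT.ext_left
        (hT.end_left.comp MulOpposite.unop_bijective)
      exists_bound := exists_subsingleton_ext_of_injectiveDimension_ne_top _ hidΓ }
  obtain ⟨hF, φ, hφ, hφnat⟩ := H.exists_doubleDual ℓ
  obtain ⟨hG, ψ, hψ, hψnat⟩ := H'.exists_doubleDual ℓ
  let η : 𝟭 _ ≅ (extRestrict Γ Λᵐᵒᵖ T ℓ hF).rightOp ⋙ extRestrict Λᵐᵒᵖ Γ T ℓ hG :=
    NatIso.ofComponents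
      (fun M => ObjectProperty.isoMk _ (@asIso _ _ _ _ _ (hφ M.obj M.property)))
      (fun {M M'} f => ObjectProperty.hom_ext _ (hφnat _ _ _ _ f.hom))
  let ε : extRestrict Λᵐᵒᵖ Γ T ℓ hG ⋙ (extRestrict Γ Λᵐᵒᵖ T ℓ hF).rightOp ≅ 𝟭 _ :=
    NatIso.ofComponents
      (fun N => (ObjectProperty.isoMk _
        (@asIso _ _ _ _ _ (hψ N.unop.obj N.unop.property)) : N.unop ≅ _).op)
      (fun {N N'} f => Quiver.Hom.unop_inj (ObjectProperty.hom_ext _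
        (hψnat _ _ _ _ f.unop.hom).symm))
  -- `η` and `ε` are unrelated natural isomorphisms; this constructor replaces the unit so that the
  -- triangle identities hold.
  let e := CategoryTheory.Equivalence.mk _ _ η ε
  refine ⟨hF, hG, e.toAdjunction, ?_, ?_⟩
  · change IsIso e.unitIso.hom
    infer_instance
  · change IsIso e.counitIso.hom
    infer_instance
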